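/- **Setting.** Let $\mathcal X\subset\mathbb R^d$ be compact, let $\Theta\subset\mathbb R^m$ be a set of hyperparameters, and let $(k_\theta)_{\theta\in\Theta}$ be symmetric positive semidefinite kernels on $\mathcal X$ with $k_\theta(x,x')\le 1$, jointly continuous in $(\theta,x,x')$. Let $f:\mathcal X\to\mathbb R$ and $B>0$. Assume (Assumption 1) that $\Theta$ is compact and bounded away from the origin, that $f$ lies in the reproducing kernel Hilbert space of $k_\theta$ for some $\theta\in\Theta$, and that $\sup_{\hat\theta\in\Theta}\|f\|_{k_{\hat\theta}}\le B$ (the norm being $\infty$ for a function outside the space). Let $T>1$, $\delta\in(0,1)$, $R>0$, $\sigma\ge 1$, $p\in\{1,2\}$. On a probability space with a filtration $(\mathcal F_t)_{t\ge0}$, in the rounds $t=1,\dots,T$ a query $x_t\in\mathcal X$ is selected by an arbitrary $\mathcal F_{t-1}$-measurable rule and $y_t=f(x_t)+\epsilon_t$ is observed, where $\epsilon_t$ is $\mathcal F_t$-measurable and conditionally $R$-sub-Gaussian: $\mathbb E[e^{\eta\epsilon_t}\mid\mathcal F_{t-1}]\le e^{\eta^2R^2/2}$ for all $\eta\in\mathbb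 R$. For $\hat\theta\in\Theta$ let $$\mu_{t-1}(x;\hat\theta)=\mathbf k_{\hat\theta}(x)^\top(K_{\hat\theta}+\sigma^2I)^{-1}\mathbf y_{t-1},\qquad \sigma_{t-1}^2(x;\hat\theta)=k_{\hat\theta}(x,x)-\mathbf k_{\hat\theta}(x)^\top(K_{\hat\theta}+\sigma^2I)^{-1}\mathbf k_{\hat\theta}(x)$$ be the Gaussian process posterior mean and variance given $(x_i,y_i)_{i<t}$, where $K_{\hat\theta}=[k_{\hat\theta}(x_i,x_j)]_{i,j<t}$, $\mathbf k_{\hat\theta}(x)=[k_{\hat\theta}(x_i,x)]_{i<t}$ and $\mathbf y_{t-1}=(y_i)_{i<t}$. Let $$\Gamma_n=\sup_{\hat\theta\in\Theta}\ \sup_{a_1,\dots,a_n\in\mathcal X}\tfrac12\log\det\big(I+\sigma^{-2}[k_{\hat\theta}(a_i,a_j)]_{i,j\le n}\big),$$ let $d(\theta,\theta')=\sup_{x,x'}|k_\theta(x,x')-k_{\theta'}(x,x')|$, let $\varepsilon_T=T^{-4}$, let $\mathcal N$ be the $\varepsilon_T$-covering number of $\Theta$ under $d$ (with centers in $\Theta$),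 and put $$\beta_t^{1/2}=B+R\sqrt{2\big(\Gamma_{t-1}+1+\log(6\mathcal N/\delta)\big)},\qquad L_t^c(\hat\theta)=\left(\frac{|y_t-\mu_{t-1}(x_t;\hat\theta)|}{\beta_t^{1/2}\sqrt{\sigma_{t-1}^2(x_t;\hat\theta)+\sigma^2}}\right)^{p}-1,$$ $$\rho=\sup_{\hat\theta\in\Theta}\frac1T\sum_{t=1}^T-L_t^c(\hat\theta),\qquad \hat\rho=\begin{cases}0.065,&p=1,\\ \dfrac{\sigma^2}{4(1+\sigma^2)},&p=2,\end{cases}$$ $$L_{\sigma^2_{t-1}}=\Big(1+\frac{t-1}{\sigma^2}\Big)^2,\qquad L_{\mu_{t-1}}=\|\mathbf y_{t-1}\|_2\Big(\frac{\sqrt{t-1}}{\sigma^2}+\frac{\sqrt{t-1}\,(t-1)}{\sigma^4}\Big).$$ **Theorem.** There is an event of probability at least $1-\delta/2$ on which both of the following hold: 1. $\rho\ge\hat\rho>0$; 2. for all $t\in\{1,\dots,T\}$, $x\in\mathcal X$ and $\hat\theta\in\Theta$, $$|f(x)-\mu_{t-1}(x;\hat\theta)|\le\beta_t^{1/2}\,\sigma_{t-1}(x;\hat\theta)+\sqrt{L_{\sigma^2_{t-1}}\,\varepsilon_T}+L_{\mu_{t-1}}\,\varepsilon_T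 .$$ -/

import Mathlib

open MeasureTheory ProbabilityTheory
open scoped ENNReal Matrix

noncomputable section

namespace OSCBO

/-! ### Kernels and their reproducing kernel Hilbert spaces -/

section Kernel

variable {𝒳 : Type*}

/-- A (real, scalar) kernel: symmetric and positive semidefinite. -/
def IsKernel (k : 𝒳 → 𝒳 → ℝ) : Prop := (Matrix.of k).PosSemidef

/-- The scalar kernel `k` as an operator-valued one, the form in which Mathlib builds the RKHS. -/
def opKernel (k : 𝒳 → 𝒳 → ℝ) : Matrix 𝒳 𝒳 (ℝ →L[ℝ] ℝ) :=
  Matrix.of fun x x' => k x x' • ContinuousLinearMap.id ℝ ℝ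

theorem IsKernel.posSemidef_opKernel {k : 𝒳 → 𝒳 → ℝ} (hk : IsKernel k) :
    (opKernel k).PosSemidef := by
  have key := (RKHS.posSemidef_tfae (K := opKernel k)).out 0 2
  refine key.mpr ⟨?_, fun v => ?_⟩
  · ext x x'
    have h := hk.1.apply x x'
    simp only [Matrix.of_apply, star_trivial] at h
    have h1 : star (ContinuousLinearMap.id ℝ ℝ) = ContinuousLinearMap.id ℝ ℝ :=
      star_one (ℝ →L[ℝ] ℝ)
    simp [opKernel, h, h1]
  · have h := hk.2 v
    rw [Finsupp.sum_comm]
    simpa [opKernel, mul_comm, mul_left_comm] using h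

/-- The norm of `f` in the reproducing kernel Hilbert space of `k`, with value `∞` if `f` does not
belong to that space (at most one `h` in the space has `⇑h = f`). -/
def rkhsNorm {k : 𝒳 → 𝒳 → ℝ} (hk : IsKernel k) (f : 𝒳 → ℝ) : ℝ≥0∞ :=
  haveI : Fact (opKernel k).PosSemidef := ⟨hk.posSemidef_opKernel⟩
  ⨅ (h : RKHS.OfKernel (opKernel k)) (_ : ⇑h = f), ‖h‖ₑ

/-! ### Gaussian process posterior and information gain -/

variable {n : ℕ}

/-- The Gram matrix of the points `a`. -/
def gram (k : 𝒳 → 𝒳 → ℝ) (a : Fin n → 𝒳) : Matrix (Fin n) (Fin n) ℝ :=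
  Matrix.of fun i j => k (a i) (a j)

/-- The vector `(k (a i) x)_i`. -/
def kvec (k : 𝒳 → 𝒳 → ℝ) (a : Fin n → 𝒳) (x : 𝒳) : Fin n → ℝ := fun i => k (a i) x

/-- Posterior mean at `x` given the data `(a i, y i)`, with noise parameter `σ ^ 2`. -/
def postMean (k : 𝒳 → 𝒳 → ℝ) (σ : ℝ) (a : Fin n → 𝒳) (y : Fin n → ℝ) (x : 𝒳) : ℝ :=
  kvec k a x ⬝ᵥ ((gram k a + σ ^ 2 • (1 : Matrix (Fin n) (Fin n) ℝ))⁻¹ *ᵥ y)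

/-- Posterior variance at `x` given the inputs `a`, with noise parameter `σ ^ 2`. -/
def postVar (k : 𝒳 → 𝒳 → ℝ) (σ : ℝ) (a : Fin n → 𝒳) (x : 𝒳) : ℝ :=
  k x x - kvec k a x ⬝ᵥ ((gram k a + σ ^ 2 • (1 : Matrix (Fin n) (Fin n) ℝ))⁻¹ *ᵥ kvec k a x)

/-- Posterior standard deviation. -/
def postStd (k : 𝒳 → 𝒳 → ℝ) (σ : ℝ) (a : Fin n → 𝒳) (x : 𝒳) : ℝ := √(postVar k σ a x)

/-- Information gain of the points `a`. -/
def infoGain (k : 𝒳 → 𝒳 → ℝ) (σ : ℝ) (a : Fin n → 𝒳) : ℝ :=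
  1 / 2 * Real.log (1 + (σ ^ 2)⁻¹ • gram k a).det

/-- Maximum information gain `γ_n` after `n` evaluations (evaluations may be repeated). -/
def maxInfoGain (k : 𝒳 → 𝒳 → ℝ) (σ : ℝ) (n : ℕ) : ℝ := ⨆ a : Fin n → 𝒳, infoGain k σ a

/-- `sup_{x, x'} |k₁(x, x') - k₂(x, x')|`. -/
def kernelDist (k₁ k₂ : 𝒳 → 𝒳 → ℝ) : ℝ := ⨆ q : 𝒳 × 𝒳, |k₁ q.1 q.2 - k₂ q.1 q.2|

end Kernel

/-! ### Families of kernels -/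

section Family

variable {𝒳 H : Type*}

/-- `Γ_n`, the maximum over the family of the maximum information gain after `n` evaluations. -/
def familyInfoGain (k : H → 𝒳 → 𝒳 → ℝ) (σ : ℝ) (n : ℕ) : ℝ := ⨆ θ : H, maxInfoGain (k θ) σ n

/-- The `ε`-covering number of the family with respect to `kernelDist`. -/
def coveringNumber (k : H → 𝒳 → 𝒳 → ℝ) (ε : ℝ) : ℕ :=
  sInf {N : ℕ | ∃ s : Finset H, s.card = N ∧ ∀ θ, ∃ θ' ∈ s, kernelDist (k θ) (k θ') ≤ ε}

/-- The resolution `ε_T = T⁻⁴`. -/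
def resolution (T : ℕ) : ℝ := ((T : ℝ) ^ 4)⁻¹

/-- The exploration scale `β_t^{1/2}` of round `t = n + 1`. -/
def betaSqrt (k : H → 𝒳 → 𝒳 → ℝ) (σ B R δ : ℝ) (T n : ℕ) : ℝ :=
  B + R * √(2 * (familyInfoGain k σ n + 1
    + Real.log (6 * (coveringNumber k (resolution T) : ℝ) / δ)))

/-- The calibration constraint `L_t^c(θ)` of round `t = n + 1`; the query and the observation of
round `t` are `x n` and `y n`, the earlier ones are `x i` and `y i` with `i < n`. -/
def calibLoss (k : H → 𝒳 → 𝒳 → ℝ) (σ B R δ : ℝ) (T p : ℕ) (x : ℕ → 𝒳) (y : ℕ → ℝ) (n : ℕ)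
    (θ : H) : ℝ :=
  |y n - postMean (k θ) σ (fun i : Fin n => x i) (fun i => y i) (x n)| ^ p
    / (betaSqrt k σ B R δ T n
        * √(postVar (k θ) σ (fun i : Fin n => x i) (x n) + σ ^ 2)) ^ p - 1

/-- The feasibility margin `ρ = sup_θ T⁻¹ ∑_t -L_t^c(θ)`. -/
def feasibilityMargin (k : H → 𝒳 → 𝒳 → ℝ) (σ B R δ : ℝ) (T p : ℕ) (x : ℕ → 𝒳) (y : ℕ → ℝ) : ℝ :=
  ⨆ θ : H, 1 / (T : ℝ) * ∑ n ∈ Finset.range T, -calibLoss k σ B R δ T p x y n θ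

/-- The lower bound `ρ̂` on the feasibility margin, for the exponents `p = 1` and `p = 2`. -/
def marginBound (σ : ℝ) (p : ℕ) : ℝ := if p = 1 then 0.065 else σ ^ 2 / (4 * (1 + σ ^ 2))

/-- Lipschitz constant `L_{σ²}`, with respect to `kernelDist`, of the posterior variance given `n`
data points. -/
def lipVar (σ : ℝ) (n : ℕ) : ℝ := (1 + n / σ ^ 2) ^ 2

/-- Lipschitz constant `L_μ`, with respect to `kernelDist`, of the posterior mean given `n` data
points with observations `y`; it is proportional to the Euclidean norm of `y`. -/
def lipMean (σ : ℝ) {n : ℕ} (y : Fin n → ℝ) : ℝ :=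
  √(∑ i, y i ^ 2) * (√n / σ ^ 2 + √n * n / σ ^ 4)

end Family

/-- The standing assumption on the hyperparameter space `Θ`, on the family of kernels indexed by it
and on the objective `f`. -/
structure RKHSAssumption {m : ℕ} (Θ : Set (Fin m → ℝ)) {𝒳 : Type*} {k : Θ → 𝒳 → 𝒳 → ℝ}
    (hk : ∀ θ, IsKernel (k θ)) (f : 𝒳 → ℝ) (B : ℝ) : Prop where
  isCompact : IsCompact Θ
  away : ∃ c : ℝ, 0 < c ∧ ∀ θ ∈ Θ, c ≤ ‖θ‖
  mem_rkhs : ∃ θ, rkhsNorm (hk θ) f < ∞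
  norm_le : (⨆ θ, rkhsNorm (hk θ) f) ≤ ENNReal.ofReal B

/-- The noise `ε` is conditionally `R`-sub-Gaussian in the first `T` rounds; round `t = n + 1` has
noise `ε n`, and `ℱ n` is the information available before its observation is revealed. -/
def CondSubGaussian {Ω : Type*} {mΩ : MeasurableSpace Ω} (P : Measure Ω) (ℱ : Filtration ℕ mΩ)
    (ε : ℕ → Ω → ℝ) (R : ℝ) (T : ℕ) : Prop :=
  ∀ n < T, ∀ η : ℝ, Integrable (fun ω => Real.exp (η * ε n ω)) P ∧
    P[fun ω => Real.exp (η * ε n ω) | ℱ n] ≤ᵐ[P] fun _ => Real.exp (η ^ 2 * R ^ 2 / 2)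

end OSCBO

end

open OSCBO

/-! The error $f(z)-\mu(z)$ splits into a bias and a noise part. In a feature space $H$ of the
kernel, both are pairings with one vector of $H\oplus\mathbb R^n$ whose norm is the posterior
standard deviation, so Cauchy–Schwarz bounds the bias by $B\sigma(z)$ and the noise by
$\sqrt{q/\sigma^2}\,\sigma(z)$ with $q=e^\top K(K+\sigma^2I)^{-1}e$
(`IsKernel.abs_sub_postMean_le`).

For a fixed kernel and noise normalized by $R$, $\exp(q/2-\text{infoGain})$ is a product of one-step
likelihood ratios (`IsKernel.prod_mixFactor`). Each ratio averages the tilts $e^{h\epsilon-h^2/2}$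
over a predictable Gaussian prior on $h$, so it does not increase expectations
(`lintegral_mul_mixFactor_le`). A Ville-type maximal inequality (`mul_measure_exists_le_prod`)
bounds $q$ in all rounds simultaneously, and a union bound covers the $\mathcal N$ centres.

An arbitrary $\theta$ has a centre within $T^{-4}$, which changes $q$ by at most
$T^{-4}n\|e\|^2/\sigma^2$ (`IsKernel.fitQuad_le_add`). The same mixture argument with a constant
prior controls $\|e\|^2$. Either this change is at most $2$, which the summand $1$ in $\beta_t$ pays
for, or $\log(6/\delta)$ is so large that the crude bound $q\le\frac{n}{n+\sigma^2}\|e\|^2$ suffices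
(`noise_le_of_norm_le`). The Lipschitz slack is not needed for the estimate.

For the margin, the normalized squared prediction errors telescope to $y^\top(K+\sigma^2I)^{-1}y$
(`IsKernel.sum_sq_div_eq_invQuad`), whose root is at most $B+\|e\|$. A second bound on $\|e\|^2$
makes their average, relative to $\beta_t$, at most $3/4$. -/

noncomputable section

namespace OSCBO

/-! ### Bordering the regularized Gram matrix by one data point. -/

section Regression

variable {𝒳 : Type*} {k : 𝒳 → 𝒳 → ℝ} {σ : ℝ} {n : ℕ}

/-- The regularized Gram matrix `K + σ² I`. -/
def regGram (k : 𝒳 → 𝒳 → ℝ) (σ : ℝ) (a : Fin n → 𝒳) : Matrix (Fin n) (Fin n) ℝ :=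
  gram k a + σ ^ 2 • (1 : Matrix (Fin n) (Fin n) ℝ)

/-- The quadratic form `yᵀ (K + σ² I)⁻¹ y`. -/
def invQuad (k : 𝒳 → 𝒳 → ℝ) (σ : ℝ) (a : Fin n → 𝒳) (y : Fin n → ℝ) : ℝ :=
  y ⬝ᵥ ((regGram k σ a)⁻¹ *ᵥ y)

/-- The quadratic form `yᵀ K (K + σ² I)⁻¹ y = |y|² - σ² yᵀ (K + σ² I)⁻¹ y`. -/
def fitQuad (k : 𝒳 → 𝒳 → ℝ) (σ : ℝ) (a : Fin n → 𝒳) (y : Fin n → ℝ) : ℝ :=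
  y ⬝ᵥ y - σ ^ 2 * invQuad k σ a y

theorem postMean_eq (k : 𝒳 → 𝒳 → ℝ) (σ : ℝ) (a : Fin n → 𝒳) (y : Fin n → ℝ) (z : 𝒳) :
    postMean k σ a y z = kvec k a z ⬝ᵥ ((regGram k σ a)⁻¹ *ᵥ y) := rfl

theorem postVar_eq (k : 𝒳 → 𝒳 → ℝ) (σ : ℝ) (a : Fin n → 𝒳) (z : 𝒳) :
    postVar k σ a z = k z z - kvec k a z ⬝ᵥ ((regGram k σ a)⁻¹ *ᵥ kvec k a z) := rfl

theorem IsKernel.symm (hk : IsKernel k) (x x' : 𝒳) : k x x' = k x' x := by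
  simpa using (hk.1.apply x x').symm

theorem IsKernel.posSemidef_gram (hk : IsKernel k) (a : Fin n → 𝒳) : (gram k a).PosSemidef :=
  Matrix.PosSemidef.submatrix hk a

theorem IsKernel.posDef_regGram (hk : IsKernel k) (hσ : 0 < σ) (a : Fin n → 𝒳) :
    (regGram k σ a).PosDef :=
  Matrix.PosDef.posSemidef_add (hk.posSemidef_gram a)
    (Matrix.PosDef.smul Matrix.PosDef.one (by positivity))

theorem IsKernel.regGram_mulVec_inv (hk : IsKernel k) (hσ : 0 < σ) (a : Fin n → 𝒳)
    (v : Fin n → ℝ) : regGram k σ a *ᵥ ((regGram k σ a)⁻¹ *ᵥ v) = v := by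
  have h : IsUnit (regGram k σ a).det :=
    (Matrix.isUnit_iff_isUnit_det _).1 (hk.posDef_regGram hσ a).isUnit
  rw [Matrix.mulVec_mulVec, Matrix.mul_nonsing_inv _ h, Matrix.one_mulVec]

theorem IsKernel.eq_inv_mulVec (hk : IsKernel k) (hσ : 0 < σ) (a : Fin n → 𝒳)
    {v w : Fin n → ℝ} (h : regGram k σ a *ᵥ w = v) : (regGram k σ a)⁻¹ *ᵥ v = w := by
  have hu : IsUnit (regGram k σ a).det :=
    (Matrix.isUnit_iff_isUnit_det _).1 (hk.posDef_regGram hσ a).isUnit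
  rw [← h, Matrix.mulVec_mulVec, Matrix.nonsing_inv_mul _ hu, Matrix.one_mulVec]

theorem regGram_mulVec (k : 𝒳 → 𝒳 → ℝ) (σ : ℝ) (a : Fin n → 𝒳) (v : Fin n → ℝ) :
    regGram k σ a *ᵥ v = gram k a *ᵥ v + σ ^ 2 • v := by
  rw [regGram, Matrix.add_mulVec, Matrix.smul_mulVec, Matrix.one_mulVec]

theorem IsKernel.dotProduct_gram_comm (hk : IsKernel k) (a : Fin n → 𝒳) (v w : Fin n → ℝ) :
    v ⬝ᵥ (gram k a *ᵥ w) = w ⬝ᵥ (gram k a *ᵥ v) := by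
  have : (gram k a)ᵀ = gram k a := by
    ext i j; exact hk.symm _ _
  rw [Matrix.dotProduct_mulVec, ← Matrix.mulVec_transpose, this, dotProduct_comm]

theorem IsKernel.dotProduct_regGram_comm (hk : IsKernel k) (a : Fin n → 𝒳) (v w : Fin n → ℝ) :
    v ⬝ᵥ (regGram k σ a *ᵥ w) = w ⬝ᵥ (regGram k σ a *ᵥ v) := by
  rw [regGram_mulVec, regGram_mulVec, dotProduct_add, dotProduct_add, dotProduct_smul,
    dotProduct_smul, hk.dotProduct_gram_comm, dotProduct_comm v w]

theorem IsKernel.dotProduct_inv_comm (hk : IsKernel k) (hσ : 0 < σ) (a : Fin n → 𝒳)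
    (v w : Fin n → ℝ) :
    v ⬝ᵥ ((regGram k σ a)⁻¹ *ᵥ w) = w ⬝ᵥ ((regGram k σ a)⁻¹ *ᵥ v) := by
  conv_lhs => rw [← hk.regGram_mulVec_inv hσ a v]
  conv_rhs => rw [← hk.regGram_mulVec_inv hσ a w]
  rw [dotProduct_comm, hk.dotProduct_regGram_comm, dotProduct_comm]

theorem IsKernel.dotProduct_gram_nonneg (hk : IsKernel k) (a : Fin n → 𝒳) (v : Fin n → ℝ) :
    0 ≤ v ⬝ᵥ (gram k a *ᵥ v) := by
  simpa using (hk.posSemidef_gram a).dotProduct_mulVec_nonneg v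

/-- The posterior variance of a new point is the Schur complement in the determinant. -/
theorem IsKernel.det_regGram_succ (hk : IsKernel k) (hσ : 0 < σ) (x : ℕ → 𝒳) (n : ℕ) :
    (regGram k σ (fun i : Fin (n + 1) => x i)).det
      = (regGram k σ (fun i : Fin n => x i)).det
        * (postVar k σ (fun i : Fin n => x i) (x n) + σ ^ 2) := by
  set A := regGram k σ (fun i : Fin n => x i) with hA
  have hu : IsUnit A.det := (Matrix.isUnit_iff_isUnit_det _).1 (hk.posDef_regGram hσ _).isUnit
  let : Invertible A := Matrix.invertibleOfIsUnitDet A hu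
  have hblock : (regGram k σ (fun i : Fin (n + 1) => x i)).submatrix
      (finSumFinEquiv (m := n) (n := 1)) finSumFinEquiv
      = Matrix.fromBlocks A (Matrix.of fun i _ => kvec k (fun i : Fin n => x i) (x n) i)
        (Matrix.of fun _ j => kvec k (fun i : Fin n => x i) (x n) j)
        (Matrix.of fun _ _ => k (x n) (x n) + σ ^ 2) := by
    ext i j
    rcases i with i | i <;> rcases j with j | j
    · simp [hA, regGram, gram, Matrix.one_apply]
    · have : Fin.castAdd 1 i ≠ Fin.natAdd n j := by
        intro h; have := congrArg Fin.val h; simp at this; omega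
      simp [regGram, gram, kvec, this]
    · have : Fin.natAdd n i ≠ Fin.castAdd 1 j := by
        intro h; have := congrArg Fin.val h; simp at this; omega
      simp [regGram, gram, kvec, this, hk.symm (x n)]
    · have : i = j := Subsingleton.elim _ _
      simp [regGram, gram, this]
  rw [← Matrix.det_submatrix_equiv_self (finSumFinEquiv (m := n) (n := 1)), hblock,
    Matrix.det_fromBlocks₁₁, Matrix.det_fin_one, Matrix.invOf_eq_nonsing_inv]
  congr 1
  rw [postVar_eq, ← hA, Matrix.dotProduct_mulVec]
  simp only [Matrix.sub_apply, Matrix.of_apply, Matrix.mul_apply, dotProduct, Matrix.vecMul]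
  ring

/-- One step of the prediction-error decomposition of `yᵀ (K + σ² I)⁻¹ y`. -/
theorem IsKernel.invQuad_succ (hk : IsKernel k) (hσ : 0 < σ) (x : ℕ → 𝒳) (y : ℕ → ℝ) (n : ℕ)
    (hv : 0 < postVar k σ (fun i : Fin n => x i) (x n) + σ ^ 2) :
    invQuad k σ (fun i : Fin (n + 1) => x i) (fun i => y i)
      = invQuad k σ (fun i : Fin n => x i) (fun i => y i)
        + (y n - postMean k σ (fun i : Fin n => x i) (fun i => y i) (x n)) ^ 2
          / (postVar k σ (fun i : Fin n => x i) (x n) + σ ^ 2) := by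
  set a : Fin n → 𝒳 := fun i => x i with ha
  set yn : Fin n → ℝ := fun i => y i with hyn
  set b := kvec k a (x n) with hb
  set μ := postMean k σ a yn (x n) with hμ
  set s := postVar k σ a (x n) + σ ^ 2 with hs
  -- Block elimination: the last coordinate of the solution of the bordered system is the prediction
  -- error over the Schur complement `s`.
  set γ := (y n - μ) / s with hγ
  set u := (regGram k σ a)⁻¹ *ᵥ yn with hu
  set c := (regGram k σ a)⁻¹ *ᵥ b with hc
  have hAu : regGram k σ a *ᵥ u = yn := hk.regGram_mulVec_inv hσ a yn
  have hAc : regGram k σ a *ᵥ c = b := hk.regGram_mulVec_inv hσ a b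
  have hbu : b ⬝ᵥ u = μ := rfl
  have hyc : yn ⬝ᵥ c = μ := by rw [hc, hk.dotProduct_inv_comm hσ]; rfl
  have hbc : b ⬝ᵥ c = k (x n) (x n) + σ ^ 2 - s := by rw [hs, postVar_eq]; ring
  have hsol : regGram k σ (fun i : Fin (n + 1) => x i) *ᵥ
      (Fin.snoc (u - γ • c) γ : Fin (n + 1) → ℝ) = fun i : Fin (n + 1) => y i := by
    funext i
    refine Fin.lastCases ?_ (fun i => ?_) i
    · have h1 : ∀ j : Fin n, (Fin.last n) ≠ Fin.castSucc j := fun j => (Fin.castSucc_ne_last j).symm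
      have h2 : ∑ j, b j * (u - γ • c) j = μ - γ * (k (x n) (x n) + σ ^ 2 - s) := by
        change b ⬝ᵥ (u - γ • c) = _
        rw [dotProduct_sub, dotProduct_smul, hbu, hbc, smul_eq_mul]
      have h3 : ∀ j : Fin n, k (x n) (x j) = b j := fun j => hk.symm _ _
      simp only [Matrix.mulVec, dotProduct, Fin.sum_univ_castSucc, Fin.snoc_castSucc, Fin.snoc_last]
      simp only [regGram, gram, Matrix.add_apply, Matrix.of_apply, Matrix.smul_apply,
        Matrix.one_apply, h1, if_false, Fin.val_last, Fin.val_castSucc, h3, if_true,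
        smul_eq_mul, mul_one, mul_zero, add_zero, h2]
      have : γ * s = y n - μ := by rw [hγ]; field_simp
      linear_combination this
    · have h1 : Fin.castSucc i ≠ Fin.last n := Fin.castSucc_ne_last i
      have h2 : ∑ j, regGram k σ a i j * (u - γ • c) j = yn i - γ * b i := by
        change (regGram k σ a *ᵥ (u - γ • c)) i = _
        rw [Matrix.mulVec_sub, Matrix.mulVec_smul, hAu, hAc]; rfl
      have h3 : ∀ j : Fin n, regGram k σ (fun i : Fin (n + 1) => x i) i.castSucc j.castSucc
          = regGram k σ a i j := fun j => by
        simp [regGram, gram, Matrix.one_apply, ha]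
      have h4 : regGram k σ (fun i : Fin (n + 1) => x i) i.castSucc (Fin.last n) = b i := by
        simp [regGram, gram, h1, hb, kvec, ha]
      simp only [Matrix.mulVec, dotProduct, Fin.sum_univ_castSucc, Fin.snoc_castSucc,
        Fin.snoc_last, h3, h4, h2, Fin.val_castSucc]
      rw [hyn]; ring
  have hq : invQuad k σ (fun i : Fin (n + 1) => x i) (fun i => y i)
      = yn ⬝ᵥ (u - γ • c) + y n * γ := by
    rw [invQuad, hk.eq_inv_mulVec hσ _ hsol]
    simp [dotProduct, Fin.sum_univ_castSucc, hyn]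
  rw [hq, dotProduct_sub, dotProduct_smul, hyc, smul_eq_mul]
  change invQuad k σ a yn - γ * μ + y n * γ = _
  rw [hγ]; field_simp; ring

end Regression

/-! ### Feature maps, and the bias and noise of the posterior mean. -/

section Feature

variable {𝒳 : Type*} {k : 𝒳 → 𝒳 → ℝ} {σ : ℝ} {n : ℕ}

/-- A kernel has a feature map, and a function of RKHS norm at most `B` is the inner product of the
features with a vector of norm at most `B`. -/
theorem IsKernel.exists_feature.{u} {𝒳 : Type u} {k : 𝒳 → 𝒳 → ℝ} (hk : IsKernel k) :
    ∃ (H : Type u) (_ : NormedAddCommGroup H) (_ : InnerProductSpace ℝ H) (φ : 𝒳 → H),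
      (∀ x x', inner ℝ (φ x) (φ x') = k x x') ∧
      ∀ (f : 𝒳 → ℝ) (B : ℝ), 0 ≤ B → rkhsNorm hk f ≤ ENNReal.ofReal B →
        ∃ h : H, ‖h‖ ≤ B ∧ ∀ x, f x = inner ℝ (φ x) h := by
  have : Fact (opKernel k).PosSemidef := ⟨hk.posSemidef_opKernel⟩
  refine ⟨RKHS.OfKernel (opKernel k), inferInstance, inferInstance,
    fun x => RKHS.kerFun (RKHS.OfKernel (opKernel k)) x 1, fun x x' => ?_, fun f B hB hf => ?_⟩
  · rw [RKHS.kerFun_inner, RKHS.kerFun_apply, RKHS.OfKernel.kernel_ofKernel]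
    simp [opKernel]
  -- If no element represents `f`, the infimum is over an empty family and equals `∞`, contradicting
  -- the finite bound.
  · by_cases hex : ∃ h : RKHS.OfKernel (opKernel k), ⇑h = f
    · obtain ⟨h, hh⟩ := hex
      refine ⟨h, ?_, fun x => ?_⟩
      · have : rkhsNorm hk f = ‖h‖ₑ := by
          rw [rkhsNorm]
          refine le_antisymm (iInf₂_le h hh) (le_iInf₂ fun g hg => ?_)
          have : g = h := DFunLike.coe_injective (hg.trans hh.symm)
          rw [this]
        rw [this, ← ofReal_norm, ENNReal.ofReal_le_ofReal_iff hB] at hf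
        exact hf
      · rw [RKHS.kerFun_inner, hh]; simp
    · have : rkhsNorm hk f = ∞ := by
        rw [rkhsNorm, eq_top_iff]
        exact le_iInf₂ fun g hg => absurd ⟨g, hg⟩ hex
      rw [this] at hf
      exact absurd hf (by simp)

variable {H : Type*} [NormedAddCommGroup H] [InnerProductSpace ℝ H] {φ : 𝒳 → H}

theorem inner_sum_feature (hφ : ∀ x x', inner ℝ (φ x) (φ x') = k x x') (a : Fin n → 𝒳)
    (v w : Fin n → ℝ) :
    inner ℝ (∑ i, v i • φ (a i)) (∑ i, w i • φ (a i)) = v ⬝ᵥ (gram k a *ᵥ w) := by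
  simp only [sum_inner, inner_smul_left]
  simp only [inner_sum, inner_smul_right, hφ, dotProduct,
    Matrix.mulVec, gram, Matrix.of_apply, Finset.mul_sum]
  refine Finset.sum_congr rfl fun i _ => Finset.sum_congr rfl fun j _ => ?_
  rw [conj_trivial]; ring

theorem inner_feature_sum (hk : IsKernel k) (hφ : ∀ x x', inner ℝ (φ x) (φ x') = k x x')
    (a : Fin n → 𝒳) (z : 𝒳) (w : Fin n → ℝ) :
    inner ℝ (φ z) (∑ i, w i • φ (a i)) = kvec k a z ⬝ᵥ w := by
  simp only [inner_sum, inner_smul_right, hφ, dotProduct, kvec]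
  exact Finset.sum_congr rfl fun i _ => by rw [hk.symm]; ring

theorem norm_sum_feature_sq (hφ : ∀ x x', inner ℝ (φ x) (φ x') = k x x') (a : Fin n → 𝒳)
    (v : Fin n → ℝ) : ‖∑ i, v i • φ (a i)‖ ^ 2 = v ⬝ᵥ (gram k a *ᵥ v) := by
  rw [← real_inner_self_eq_norm_sq, inner_sum_feature hφ]

/-- The posterior variance as the regularized distance of `φ z` to the span of the features. -/
theorem postVar_eq_norm_sq_add (hk : IsKernel k) (hφ : ∀ x x', inner ℝ (φ x) (φ x') = k x x')
    (hσ : 0 < σ) (a : Fin n → 𝒳) (z : 𝒳) :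
    postVar k σ a z
      = ‖φ z - ∑ i, ((regGram k σ a)⁻¹ *ᵥ kvec k a z) i • φ (a i)‖ ^ 2
        + σ ^ 2 * (((regGram k σ a)⁻¹ *ᵥ kvec k a z) ⬝ᵥ ((regGram k σ a)⁻¹ *ᵥ kvec k a z)) := by
  have h := hk.regGram_mulVec_inv hσ a (kvec k a z)
  rw [postVar_eq]
  set c := (regGram k σ a)⁻¹ *ᵥ kvec k a z
  have h2 : c ⬝ᵥ (gram k a *ᵥ c) + σ ^ 2 * (c ⬝ᵥ c) = kvec k a z ⬝ᵥ c := by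
    rw [← smul_eq_mul, ← dotProduct_smul, ← dotProduct_add, ← regGram_mulVec, h, dotProduct_comm]
  rw [norm_sub_sq_real, norm_sum_feature_sq hφ, inner_feature_sum hk hφ,
    ← real_inner_self_eq_norm_sq, hφ]
  linarith

theorem IsKernel.postVar_nonneg (hk : IsKernel k) (hσ : 0 < σ) (a : Fin n → 𝒳) (z : 𝒳) :
    0 ≤ postVar k σ a z := by
  obtain ⟨H, _, _, φ, hφ, -⟩ := hk.exists_feature
  rw [postVar_eq_norm_sq_add hk hφ hσ]
  have := dotProduct_self_star_nonneg ((regGram k σ a)⁻¹ *ᵥ kvec k a z)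
  simp only [star_trivial] at this
  positivity

/-- Zero variance forces the weights $(K+\sigma^2I)^{-1}k_z$ to vanish. This handles the degenerate
prior in the mixture argument. -/
theorem IsKernel.postMean_eq_zero (hk : IsKernel k) (hσ : 0 < σ) (a : Fin n → 𝒳)
    (y : Fin n → ℝ) (z : 𝒳) (h : postVar k σ a z = 0) : postMean k σ a y z = 0 := by
  obtain ⟨H, _, _, φ, hφ, -⟩ := hk.exists_feature
  rw [postVar_eq_norm_sq_add hk hφ hσ] at h
  have h1 := dotProduct_self_star_nonneg ((regGram k σ a)⁻¹ *ᵥ kvec k a z)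
  simp only [star_trivial] at h1
  have h2 : ((regGram k σ a)⁻¹ *ᵥ kvec k a z) ⬝ᵥ ((regGram k σ a)⁻¹ *ᵥ kvec k a z) = 0 := by
    have hs : 0 < σ ^ 2 := by positivity
    nlinarith [sq_nonneg ‖φ z - ∑ i, ((regGram k σ a)⁻¹ *ᵥ kvec k a z) i • φ (a i)‖]
  rw [dotProduct_self_eq_zero] at h2
  rw [postMean_eq, hk.dotProduct_inv_comm hσ, h2, dotProduct_zero]

theorem IsKernel.abs_le_one (hk : IsKernel k) (hk1 : ∀ x x', k x x' ≤ 1) (x x' : 𝒳) :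
    |k x x'| ≤ 1 := by
  obtain ⟨H, _, _, φ, hφ, -⟩ := hk.exists_feature
  have h1 : ∀ z, ‖φ z‖ ≤ 1 := fun z => by
    have : ‖φ z‖ ^ 2 ≤ 1 := by rw [← real_inner_self_eq_norm_sq, hφ]; exact hk1 z z
    nlinarith [norm_nonneg (φ z)]
  rw [← hφ]
  calc _ ≤ ‖φ x‖ * ‖φ x'‖ := abs_real_inner_le_norm _ _
    _ ≤ 1 * 1 := by gcongr <;> exact h1 _
    _ = 1 := one_mul 1

/-- With $w=(K+\sigma^2I)^{-1}e$, substitute $e=Kw+\sigma^2w$. The right side is the squared norm of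
$(\sum_i w_i\varphi(a_i),\sigma^{-1}Kw)$ in $H\oplus\mathbb R^n$, the vector that the noise pairs
with. -/
theorem IsKernel.fitQuad_eq (hk : IsKernel k) (hσ : 0 < σ) (a : Fin n → 𝒳) (e : Fin n → ℝ) :
    fitQuad k σ a e / σ ^ 2
      = ((regGram k σ a)⁻¹ *ᵥ e) ⬝ᵥ (gram k a *ᵥ ((regGram k σ a)⁻¹ *ᵥ e))
        + (σ⁻¹ • (gram k a *ᵥ ((regGram k σ a)⁻¹ *ᵥ e)))
          ⬝ᵥ (σ⁻¹ • (gram k a *ᵥ ((regGram k σ a)⁻¹ *ᵥ e))) := by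
  have h := hk.regGram_mulVec_inv hσ a e
  rw [fitQuad, invQuad]
  set w := (regGram k σ a)⁻¹ *ᵥ e
  set g := gram k a *ᵥ w with hg
  have he : e = g + σ ^ 2 • w := by rw [← h, regGram_mulVec]
  rw [he]
  simp only [dotProduct_add, add_dotProduct, dotProduct_smul, smul_dotProduct, smul_eq_mul]
  rw [dotProduct_comm w g]
  field_simp
  ring

theorem IsKernel.fitQuad_nonneg (hk : IsKernel k) (hσ : 0 < σ) (a : Fin n → 𝒳)
    (e : Fin n → ℝ) : 0 ≤ fitQuad k σ a e := by
  have h : 0 ≤ fitQuad k σ a e / σ ^ 2 := by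
    rw [hk.fitQuad_eq hσ]
    have := dotProduct_self_star_nonneg (σ⁻¹ • (gram k a *ᵥ ((regGram k σ a)⁻¹ *ᵥ e)))
    simp only [star_trivial] at this
    exact add_nonneg (hk.dotProduct_gram_nonneg a _) this
  have hs : 0 < σ ^ 2 := by positivity
  simpa [div_mul_cancel₀ _ hs.ne'] using mul_nonneg h hs.le

theorem inner_add_dotProduct_le (u v : H) (c r : Fin n → ℝ) :
    |inner ℝ u v + c ⬝ᵥ r| ≤ √(‖u‖ ^ 2 + c ⬝ᵥ c) * √(‖v‖ ^ 2 + r ⬝ᵥ r) := by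
  have h := abs_real_inner_le_norm
    (WithLp.toLp 2 (u, WithLp.toLp 2 c) : WithLp 2 (H × EuclideanSpace ℝ (Fin n)))
    (WithLp.toLp 2 (v, WithLp.toLp 2 r))
  rw [WithLp.prod_norm_eq_of_L2, WithLp.prod_norm_eq_of_L2] at h
  simp only [WithLp.prod_inner_apply, EuclideanSpace.inner_eq_star_dotProduct,
    EuclideanSpace.norm_sq_eq, star_trivial, Real.norm_eq_abs, sq_abs] at h
  simp only [dotProduct] at h ⊢
  convert h using 4 <;> first | rfl | (simp [mul_comm, sq])

/-- The deterministic confidence bound: bias plus noise. -/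
theorem IsKernel.abs_sub_postMean_le (hk : IsKernel k) (hσ : 0 < σ) {f : 𝒳 → ℝ} {B : ℝ}
    (hB : 0 ≤ B) (hf : rkhsNorm hk f ≤ ENNReal.ofReal B) (a : Fin n → 𝒳) (e : Fin n → ℝ) (z : 𝒳) :
    |f z - postMean k σ a (fun i => f (a i) + e i) z|
      ≤ (B + √(fitQuad k σ a e / σ ^ 2)) * postStd k σ a z := by
  obtain ⟨H, _, _, φ, hφ, hrep⟩ := hk.exists_feature
  obtain ⟨h, hhB, hfh⟩ := hrep f B hB hf
  have hvar := postVar_eq_norm_sq_add hk hφ hσ a z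
  have hAc := hk.regGram_mulVec_inv hσ a (kvec k a z)
  have hAw := hk.regGram_mulVec_inv hσ a e
  have hfit := hk.fitQuad_eq hσ a e
  have hμ : postMean k σ a (fun i => f (a i) + e i) z
      = (fun i => f (a i) + e i) ⬝ᵥ ((regGram k σ a)⁻¹ *ᵥ kvec k a z) := by
    rw [postMean_eq, hk.dotProduct_inv_comm hσ]
  have hce : ((regGram k σ a)⁻¹ *ᵥ kvec k a z) ⬝ᵥ e
      = kvec k a z ⬝ᵥ ((regGram k σ a)⁻¹ *ᵥ e) := by
    rw [dotProduct_comm, hk.dotProduct_inv_comm hσ]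
  rw [hμ]
  set c := (regGram k σ a)⁻¹ *ᵥ kvec k a z
  set w := (regGram k σ a)⁻¹ *ᵥ e
  set u := φ z - ∑ i, c i • φ (a i) with hu
  -- The bias pairs $(u,\sigma c)$ with $(h,0)$. In the noise pairing the terms $c^\top Kw$ cancel,
  -- leaving $k_z^\top w=c^\top e$.
  have hdec : f z - (fun i => f (a i) + e i) ⬝ᵥ c
      = (inner ℝ u h + (σ • c) ⬝ᵥ (0 : Fin n → ℝ))
        - (inner ℝ u (∑ i, w i • φ (a i)) + (σ • c) ⬝ᵥ (σ⁻¹ • (gram k a *ᵥ w))) := by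
    rw [hu, inner_sub_left, inner_sub_left, inner_sum_feature hφ, inner_feature_sum hk hφ, ← hce,
      dotProduct_zero, smul_dotProduct, dotProduct_smul, sum_inner, smul_smul,
      mul_inv_cancel₀ hσ.ne', one_smul, ← hfh]
    have h1 : (fun i => f (a i) + e i) ⬝ᵥ c
        = ∑ i, inner ℝ (c i • φ (a i)) h + c ⬝ᵥ e := by
      simp only [dotProduct, ← Finset.sum_add_distrib, inner_smul_left, ← hfh]
      exact Finset.sum_congr rfl fun i _ => by simp; ring
    rw [h1]; ring
  have hstd : √(‖u‖ ^ 2 + (σ • c) ⬝ᵥ (σ • c)) = postStd k σ a z := by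
    rw [postStd, hvar, smul_dotProduct, dotProduct_smul, smul_smul, smul_eq_mul, sq σ]
  have hb1 := inner_add_dotProduct_le u h (σ • c) 0
  have hb2 := inner_add_dotProduct_le u (∑ i, w i • φ (a i)) (σ • c) (σ⁻¹ • (gram k a *ᵥ w))
  rw [hstd, norm_sum_feature_sq hφ, ← hfit] at hb2
  rw [hstd, dotProduct_zero (0 : Fin n → ℝ), add_zero (‖h‖ ^ 2), Real.sqrt_sq (norm_nonneg h)]
    at hb1
  have hs0 : 0 ≤ postStd k σ a z := Real.sqrt_nonneg _
  rw [hdec]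
  calc _ ≤ _ := abs_sub _ _
    _ ≤ postStd k σ a z * ‖h‖ + postStd k σ a z * √(fitQuad k σ a e / σ ^ 2) := add_le_add hb1 hb2
    _ ≤ postStd k σ a z * B + postStd k σ a z * √(fitQuad k σ a e / σ ^ 2) := by gcongr
    _ = _ := by ring

/-- For $v=(K+\sigma^2I)^{-1}f$ and $g=\|\sum_i v_i\varphi(a_i)\|$, one has $g^2\le f^\top v\le gB$.
-/
theorem IsKernel.invQuad_rkhs_le (hk : IsKernel k) (hσ : 0 < σ) {f : 𝒳 → ℝ} {B : ℝ}
    (hB : 0 ≤ B) (hf : rkhsNorm hk f ≤ ENNReal.ofReal B) (a : Fin n → 𝒳) :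
    invQuad k σ a (fun i => f (a i)) ≤ B ^ 2 := by
  obtain ⟨H, _, _, φ, hφ, hrep⟩ := hk.exists_feature
  obtain ⟨h, hhB, hfh⟩ := hrep f B hB hf
  have hA := hk.regGram_mulVec_inv hσ a (fun i => f (a i))
  rw [invQuad]
  set v := (regGram k σ a)⁻¹ *ᵥ (fun i => f (a i))
  have h1 : (fun i => f (a i)) ⬝ᵥ v = inner ℝ (∑ i, v i • φ (a i)) h := by
    simp only [dotProduct, sum_inner, inner_smul_left, ← hfh]
    exact Finset.sum_congr rfl fun i _ => by simp; ring
  have h2 : ‖∑ i, v i • φ (a i)‖ ^ 2 ≤ (fun i => f (a i)) ⬝ᵥ v := by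
    rw [norm_sum_feature_sq hφ]
    conv_rhs => rw [← hA, regGram_mulVec, dotProduct_comm, dotProduct_add, dotProduct_smul]
    have := dotProduct_self_star_nonneg v
    simp only [star_trivial] at this
    rw [smul_eq_mul]
    nlinarith [sq_nonneg σ]
  have h3 := real_inner_le_norm (∑ i, v i • φ (a i)) h
  rw [← h1] at h3
  set g := ‖∑ i, v i • φ (a i)‖
  have : 0 ≤ g := norm_nonneg _
  nlinarith [norm_nonneg h, sq_nonneg (g - ‖h‖), sq_nonneg (g - B)]

end Feature

/-! ### Size and kernel stability of the quadratic forms. -/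

section QuadraticForms

variable {𝒳 : Type*} {k k' : 𝒳 → 𝒳 → ℝ} {σ : ℝ} {n : ℕ}

theorem dotProduct_self_nonneg_real (v : Fin n → ℝ) : 0 ≤ v ⬝ᵥ v := by
  simpa using dotProduct_self_star_nonneg v

theorem IsKernel.invQuad_nonneg (hk : IsKernel k) (hσ : 0 < σ) (a : Fin n → 𝒳)
    (v : Fin n → ℝ) : 0 ≤ invQuad k σ a v := by
  simpa [invQuad] using (hk.posDef_regGram hσ a).inv.posSemidef.dotProduct_mulVec_nonneg v

theorem IsKernel.invQuad_add_smul (hk : IsKernel k) (hσ : 0 < σ) (a : Fin n → 𝒳)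
    (v w : Fin n → ℝ) (t : ℝ) :
    invQuad k σ a (v + t • w)
      = invQuad k σ a w * (t * t) + 2 * (v ⬝ᵥ ((regGram k σ a)⁻¹ *ᵥ w)) * t + invQuad k σ a v := by
  simp only [invQuad, Matrix.mulVec_add, Matrix.mulVec_smul, dotProduct_add, add_dotProduct,
    dotProduct_smul, smul_dotProduct, smul_eq_mul]
  rw [hk.dotProduct_inv_comm hσ a w v]
  ring

theorem IsKernel.dotProduct_inv_sq_le (hk : IsKernel k) (hσ : 0 < σ) (a : Fin n → 𝒳)
    (v w : Fin n → ℝ) :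
    (v ⬝ᵥ ((regGram k σ a)⁻¹ *ᵥ w)) ^ 2 ≤ invQuad k σ a v * invQuad k σ a w := by
  have h := discrim_le_zero (a := invQuad k σ a w) (b := 2 * (v ⬝ᵥ ((regGram k σ a)⁻¹ *ᵥ w)))
    (c := invQuad k σ a v) fun t => by
      rw [← hk.invQuad_add_smul hσ]; exact hk.invQuad_nonneg hσ a _
  rw [discrim] at h
  nlinarith

theorem IsKernel.invQuad_le (hk : IsKernel k) (hσ : 0 < σ) (a : Fin n → 𝒳) (v : Fin n → ℝ) :
    invQuad k σ a v ≤ v ⬝ᵥ v / σ ^ 2 := by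
  have h := hk.fitQuad_nonneg hσ a v
  rw [fitQuad] at h
  rw [le_div_iff₀ (by positivity)]
  linarith

/-- Triangle inequality for the norm whose square is `invQuad`; it separates signal from noise in
the observations. -/
theorem IsKernel.invQuad_add_le (hk : IsKernel k) (hσ : 0 < σ) (a : Fin n → 𝒳)
    {v w : Fin n → ℝ} {b c : ℝ} (hb : 0 ≤ b) (hc : 0 ≤ c) (hv : invQuad k σ a v ≤ b ^ 2)
    (hw : invQuad k σ a w ≤ c ^ 2) : invQuad k σ a (v + w) ≤ (b + c) ^ 2 := by
  have h1 := hk.invQuad_add_smul hσ a v w 1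
  rw [one_smul] at h1
  have h2 := hk.dotProduct_inv_sq_le hσ a v w
  have h3 : (v ⬝ᵥ ((regGram k σ a)⁻¹ *ᵥ w)) ^ 2 ≤ (b * c) ^ 2 := by
    rw [mul_pow]
    exact h2.trans (mul_le_mul hv hw (hk.invQuad_nonneg hσ a _) (by positivity))
  have h4 := abs_le_of_sq_le_sq' h3 (by positivity)
  rw [h1]; nlinarith [h4.2]

theorem abs_dotProduct_mulVec_le {M : Matrix (Fin n) (Fin n) ℝ} {c : ℝ} (hc : 0 ≤ c)
    (hM : ∀ i j, |M i j| ≤ c) (v w : Fin n → ℝ) :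
    |v ⬝ᵥ (M *ᵥ w)| ≤ c * n * (√(v ⬝ᵥ v) * √(w ⬝ᵥ w)) := by
  have hl1 : ∀ u : Fin n → ℝ, ∑ i, |u i| ≤ √n * √(u ⬝ᵥ u) := fun u => by
    rw [← Real.sqrt_mul (Nat.cast_nonneg n)]
    refine Real.le_sqrt_of_sq_le ?_
    have := sq_sum_le_card_mul_sum_sq (s := Finset.univ) (f := fun i => |u i|)
    simpa [dotProduct, sq] using this
  calc |v ⬝ᵥ (M *ᵥ w)| ≤ ∑ i, ∑ j, |v i| * (c * |w j|) := by
        simp only [dotProduct, Matrix.mulVec, Finset.mul_sum]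
        refine (Finset.abs_sum_le_sum_abs _ _).trans (Finset.sum_le_sum fun i _ => ?_)
        refine (Finset.abs_sum_le_sum_abs _ _).trans (Finset.sum_le_sum fun j _ => ?_)
        rw [abs_mul, abs_mul]
        gcongr
        exact hM i j
    _ = c * ((∑ i, |v i|) * ∑ j, |w j|) := by
        rw [Finset.sum_mul_sum, Finset.mul_sum]
        refine Finset.sum_congr rfl fun i _ => ?_
        rw [Finset.mul_sum]
        exact Finset.sum_congr rfl fun j _ => by ring
    _ ≤ c * ((√n * √(v ⬝ᵥ v)) * (√n * √(w ⬝ᵥ w))) := by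
        gcongr
        · exact hl1 v
        · exact hl1 w
    _ = c * (√n * √n) * (√(v ⬝ᵥ v) * √(w ⬝ᵥ w)) := by ring
    _ = _ := by rw [Real.mul_self_sqrt (Nat.cast_nonneg n)]

/-- Entries bounded by $1$ give $K\le nI$. Cauchy–Schwarz for the inverse form, applied to $e$ and
$(K+\sigma^2I)e$, turns this into a lower bound on `invQuad`. The factor being strictly below $1$
matters in `noise_le_of_norm_le`. -/
theorem IsKernel.fitQuad_le (hk : IsKernel k) (hk1 : ∀ x x', k x x' ≤ 1) (hσ : 0 < σ)
    (a : Fin n → 𝒳) (e : Fin n → ℝ) :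
    fitQuad k σ a e ≤ n / (n + σ ^ 2) * (e ⬝ᵥ e) := by
  have hs : 0 < σ ^ 2 := by positivity
  have hn : (0 : ℝ) ≤ n := Nat.cast_nonneg n
  have he := dotProduct_self_nonneg_real e
  have h1 : e ⬝ᵥ (regGram k σ a *ᵥ e) ≤ (n + σ ^ 2) * (e ⬝ᵥ e) := by
    have := (abs_le.1 (abs_dotProduct_mulVec_le zero_le_one
      (fun i j => hk.abs_le_one hk1 (a i) (a j)) e e (M := gram k a))).2
    rw [Real.mul_self_sqrt he] at this
    rw [regGram_mulVec, dotProduct_add, dotProduct_smul, smul_eq_mul]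
    linarith
  have h2 := hk.dotProduct_inv_sq_le hσ a e (regGram k σ a *ᵥ e)
  rw [hk.eq_inv_mulVec hσ a rfl] at h2
  have h3 : invQuad k σ a (regGram k σ a *ᵥ e) ≤ (n + σ ^ 2) * (e ⬝ᵥ e) := by
    rw [invQuad, hk.eq_inv_mulVec hσ a rfl, dotProduct_comm]; exact h1
  have h0 := hk.invQuad_nonneg hσ a e
  have h4 : (e ⬝ᵥ e) ≤ (n + σ ^ 2) * invQuad k σ a e := by
    rcases he.eq_or_lt with h | h
    · rw [← h]; positivity
    · have : (e ⬝ᵥ e) * (e ⬝ᵥ e) ≤ ((n + σ ^ 2) * invQuad k σ a e) * (e ⬝ᵥ e) := by nlinarith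
      exact le_of_mul_le_mul_right this h
  rw [fitQuad, div_mul_eq_mul_div, le_div_iff₀ (by positivity)]
  nlinarith

theorem IsKernel.sqrt_inv_mulVec_le (hk : IsKernel k) (hσ : 0 < σ) (a : Fin n → 𝒳)
    (e : Fin n → ℝ) :
    √(((regGram k σ a)⁻¹ *ᵥ e) ⬝ᵥ ((regGram k σ a)⁻¹ *ᵥ e)) ≤ √(e ⬝ᵥ e) / σ ^ 2 := by
  have h := hk.regGram_mulVec_inv hσ a e
  set w := (regGram k σ a)⁻¹ *ᵥ e
  have hw := dotProduct_self_nonneg_real w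
  have he := dotProduct_self_nonneg_real e
  have h1 : σ ^ 2 * (w ⬝ᵥ w) ≤ w ⬝ᵥ e := by
    have := hk.dotProduct_gram_nonneg a w
    rw [← h, regGram_mulVec, dotProduct_add, dotProduct_smul, smul_eq_mul]
    linarith
  have h2 : w ⬝ᵥ e ≤ √(w ⬝ᵥ w) * √(e ⬝ᵥ e) := by
    simpa [dotProduct, sq] using Real.sum_mul_le_sqrt_mul_sqrt Finset.univ w e
  rw [le_div_iff₀ (by positivity)]
  rcases hw.eq_or_lt with h0 | h0
  · rw [← h0]; simp
  · have hp : 0 < √(w ⬝ᵥ w) := Real.sqrt_pos.2 h0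
    have h3 := Real.mul_self_sqrt hw
    refine le_of_mul_le_mul_left ?_ hp
    nlinarith

/-- Stability of the fitted quadratic form under a uniform perturbation of the kernel. -/
theorem IsKernel.fitQuad_le_add (hk : IsKernel k) (hk' : IsKernel k') (hσ : 0 < σ) {c : ℝ}
    (hc : 0 ≤ c) (hd : ∀ x x', |k x x' - k' x x'| ≤ c) (a : Fin n → 𝒳) (e : Fin n → ℝ) :
    fitQuad k σ a e ≤ fitQuad k' σ a e + c * n * (e ⬝ᵥ e) / σ ^ 2 := by
  have hs : 0 < σ ^ 2 := by positivity
  have he := dotProduct_self_nonneg_real e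
  have h := hk.regGram_mulVec_inv hσ a e
  have h' := hk'.regGram_mulVec_inv hσ a e
  have hw := hk.sqrt_inv_mulVec_le hσ a e
  have hw' := hk'.sqrt_inv_mulVec_le hσ a e
  rw [fitQuad, fitQuad, invQuad, invQuad]
  set w := (regGram k σ a)⁻¹ *ᵥ e
  set w' := (regGram k' σ a)⁻¹ *ᵥ e
  -- Resolvent identity $A'^{-1}-A^{-1}=A^{-1}(A-A')A'^{-1}$, in which the $\sigma^2I$ terms cancel.
  have h1 : e ⬝ᵥ w' - e ⬝ᵥ w = w ⬝ᵥ ((gram k a - gram k' a) *ᵥ w') := by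
    have e1 : e ⬝ᵥ w' = w ⬝ᵥ (regGram k σ a *ᵥ w') := by
      rw [hk.dotProduct_regGram_comm, h, dotProduct_comm]
    have e2 : e ⬝ᵥ w = w ⬝ᵥ (regGram k' σ a *ᵥ w') := by rw [h', dotProduct_comm]
    rw [e1, e2, regGram_mulVec, regGram_mulVec, Matrix.sub_mulVec, dotProduct_add, dotProduct_add,
      dotProduct_sub]
    ring
  have h2 := (abs_le.1 (abs_dotProduct_mulVec_le hc
    (fun i j => hd (a i) (a j)) w w' (M := gram k a - gram k' a))).2
  have h3 : √(w ⬝ᵥ w) * √(w' ⬝ᵥ w') ≤ (√(e ⬝ᵥ e) / σ ^ 2) * (√(e ⬝ᵥ e) / σ ^ 2) := by gcongr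
  have h4 : (√(e ⬝ᵥ e) / σ ^ 2) * (√(e ⬝ᵥ e) / σ ^ 2) = (e ⬝ᵥ e) / σ ^ 2 / σ ^ 2 := by
    rw [div_mul_div_comm, Real.mul_self_sqrt he, div_div]
  have h5 : e ⬝ᵥ w' - e ⬝ᵥ w ≤ c * n * ((e ⬝ᵥ e) / σ ^ 2 / σ ^ 2) := by
    rw [h1]
    refine h2.trans ?_
    rw [← h4]
    gcongr
  have h6 : σ ^ 2 * (c * n * ((e ⬝ᵥ e) / σ ^ 2 / σ ^ 2)) = c * n * (e ⬝ᵥ e) / σ ^ 2 := by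
    field_simp
  nlinarith

end QuadraticForms

/-! ### Telescoping over the rounds. -/

section Sequential

variable {𝒳 : Type*} {k : 𝒳 → 𝒳 → ℝ} {σ : ℝ}

theorem IsKernel.sum_sq_div_eq_invQuad (hk : IsKernel k) (hσ : 0 < σ) (x : ℕ → 𝒳) (y : ℕ → ℝ)
    (n : ℕ) :
    ∑ i ∈ Finset.range n, (y i - postMean k σ (fun j : Fin i => x j) (fun j => y j) (x i)) ^ 2
        / (postVar k σ (fun j : Fin i => x j) (x i) + σ ^ 2)
      = invQuad k σ (fun i : Fin n => x i) (fun i => y i) := by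
  induction n with
  | zero => simp [invQuad]
  | succ n ih =>
    have := hk.postVar_nonneg hσ (fun j : Fin n => x j) (x n)
    rw [Finset.sum_range_succ, ih, hk.invQuad_succ hσ x y n (by positivity)]

theorem infoGain_eq_log_det (hσ : 0 < σ) {n : ℕ} (a : Fin n → 𝒳) :
    infoGain k σ a = 1 / 2 * Real.log (((σ ^ 2)⁻¹) ^ n * (regGram k σ a).det) := by
  have : 1 + (σ ^ 2)⁻¹ • gram k a = (σ ^ 2)⁻¹ • regGram k σ a := by
    rw [regGram, smul_add, smul_smul, inv_mul_cancel₀ (by positivity), one_smul, add_comm]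
  rw [infoGain, this, Matrix.det_smul, Fintype.card_fin]

theorem IsKernel.infoGain_succ (hk : IsKernel k) (hσ : 0 < σ) (x : ℕ → 𝒳) (n : ℕ) :
    infoGain k σ (fun i : Fin (n + 1) => x i)
      = infoGain k σ (fun i : Fin n => x i)
        + 1 / 2 * Real.log (1 + postVar k σ (fun i : Fin n => x i) (x n) / σ ^ 2) := by
  have hv := hk.postVar_nonneg hσ (fun j : Fin n => x j) (x n)
  have hd := (hk.posDef_regGram hσ (fun i : Fin n => x i)).det_pos
  rw [infoGain_eq_log_det hσ, infoGain_eq_log_det hσ, hk.det_regGram_succ hσ, ← mul_add,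
    ← Real.log_mul (by positivity) (by positivity)]
  congr 2
  rw [pow_succ]
  field_simp
  ring

theorem IsKernel.infoGain_nonneg (hk : IsKernel k) (hσ : 0 < σ) (x : ℕ → 𝒳) (n : ℕ) :
    0 ≤ infoGain k σ (fun i : Fin n => x i) := by
  induction n with
  | zero => simp [infoGain]
  | succ n ih =>
    rw [hk.infoGain_succ hσ]
    have := hk.postVar_nonneg hσ (fun j : Fin n => x j) (x n)
    have : 0 ≤ Real.log (1 + postVar k σ (fun i : Fin n => x i) (x n) / σ ^ 2) :=
      Real.log_nonneg (by linarith [div_nonneg this (sq_nonneg σ)])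
    positivity

/-- The likelihood ratio at `e` of the Gaussians `N(m, 1 + v)` and `N(0, 1)`. -/
def mixFactor (e m v : ℝ) : ℝ :=
  Real.exp ((e ^ 2 - (e - m) ^ 2 / (1 + v)) / 2 - Real.log (1 + v) / 2)

/-- The chain rule for Gaussian likelihoods: `invQuad` grows by a normalized squared error and
`infoGain` by half a log-variance. The prior in round $i$ is the posterior fitted to the earlier
noise, hence predictable. -/
theorem IsKernel.prod_mixFactor (hk : IsKernel k) (hσ : 0 < σ) (x : ℕ → 𝒳) (e : ℕ → ℝ) (n : ℕ) :
    ∏ i ∈ Finset.range n, mixFactor (e i) (postMean k σ (fun j : Fin i => x j) (fun j => e j) (x i))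
        (postVar k σ (fun j : Fin i => x j) (x i) / σ ^ 2)
      = Real.exp (fitQuad k σ (fun i : Fin n => x i) (fun i => e i) / 2
          - infoGain k σ (fun i : Fin n => x i)) := by
  induction n with
  | zero => simp [fitQuad, invQuad, infoGain]
  | succ n ih =>
    have hv := hk.postVar_nonneg hσ (fun j : Fin n => x j) (x n)
    have hp : 0 < postVar k σ (fun j : Fin n => x j) (x n) + σ ^ 2 := by positivity
    rw [Finset.prod_range_succ, ih, mixFactor, ← Real.exp_add, hk.infoGain_succ hσ]
    congr 1
    have h1 : (fun i : Fin (n + 1) => e i) ⬝ᵥ (fun i : Fin (n + 1) => e i)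
        = (fun i : Fin n => e i) ⬝ᵥ (fun i : Fin n => e i) + e n ^ 2 := by
      simp [dotProduct, Fin.sum_univ_castSucc, sq]
    rw [fitQuad, fitQuad, hk.invQuad_succ hσ x e n hp, h1]
    set s := postVar k σ (fun j : Fin n => x j) (x n)
    have h2 : ∀ r : ℝ, r / (1 + s / σ ^ 2) = σ ^ 2 * (r / (s + σ ^ 2)) := fun r => by
      field_simp; ring
    rw [h2]
    ring

end Sequential

/-! ### Gaussian mixtures of exponential tilts and the maximal inequality. -/

section Mixture

theorem measurable_mixFactor {Ω : Type*} {m₀ : MeasurableSpace Ω} {e m v : Ω → ℝ}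
    (he : Measurable e) (hm : Measurable m) (hv : Measurable v) :
    Measurable fun ω => mixFactor (e ω) (m ω) (v ω) := by
  unfold mixFactor
  exact Real.measurable_exp.comp (((((he.pow_const 2).sub (((he.sub hm).pow_const 2).div
    (hv.const_add 1))).div_const 2)).sub ((Real.measurable_log.comp (hv.const_add 1)).div_const 2))

/-- Bayes' rule for a prior $N(m,v)$ on $h$ and one observation $e\sim N(h,1)$: completing the
square leaves the evidence ratio times the posterior density. -/
theorem exp_mul_gaussianPDFReal (e m h : ℝ) {v : ℝ} (hv : 0 < v) :
    Real.exp (h * e) * (Real.exp (-(h ^ 2 / 2)) * gaussianPDFReal m v.toNNReal h)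
      = mixFactor e m v
        * gaussianPDFReal ((m + e * v) / (1 + v)) (v / (1 + v)).toNNReal h := by
  have h1 : 0 < 1 + v := by positivity
  have h2 : 0 < v / (1 + v) := by positivity
  have hlog : Real.exp (-(Real.log (1 + v) / 2)) = (√(1 + v))⁻¹ := by
    rw [Real.exp_neg, Real.sqrt_eq_rpow, Real.rpow_def_of_pos h1]
    congr 2; ring
  have hsq : √(2 * Real.pi * (v / (1 + v))) = √(2 * Real.pi * v) / √(1 + v) := by
    rw [← Real.sqrt_div (by positivity), mul_div_assoc]
  have hs1 : 0 < √(1 + v) := Real.sqrt_pos.2 h1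
  have hs2 : 0 < √(2 * Real.pi * v) := Real.sqrt_pos.2 (by positivity)
  rw [gaussianPDFReal, gaussianPDFReal, Real.coe_toNNReal _ hv.le, Real.coe_toNNReal _ h2.le,
    mixFactor, sub_eq_add_neg _ (Real.log (1 + v) / 2), Real.exp_add, hlog, hsq]
  have hexp : Real.exp (h * e) * Real.exp (-(h ^ 2 / 2)) * Real.exp (-(h - m) ^ 2 / (2 * v))
      = Real.exp ((e ^ 2 - (e - m) ^ 2 / (1 + v)) / 2)
        * Real.exp (-(h - (m + e * v) / (1 + v)) ^ 2 / (2 * (v / (1 + v)))) := by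
    rw [← Real.exp_add, ← Real.exp_add, ← Real.exp_add]
    congr 1
    field_simp
    ring
  calc _ = (√(2 * Real.pi * v))⁻¹
        * (Real.exp (h * e) * Real.exp (-(h ^ 2 / 2)) * Real.exp (-(h - m) ^ 2 / (2 * v))) := by
        ring
    _ = _ := by
        rw [hexp, inv_div]
        field_simp

/-- The mixture factor is the average of exponential tilts over a Gaussian prior. -/
theorem lintegral_exp_mul_gaussianPDFReal (e m : ℝ) {v : ℝ} (hv : 0 < v) :
    ∫⁻ h, ENNReal.ofReal (Real.exp (h * e))
        * ENNReal.ofReal (Real.exp (-(h ^ 2 / 2)) * gaussianPDFReal m v.toNNReal h)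
      = ENNReal.ofReal (mixFactor e m v) := by
  have h2 : 0 < v / (1 + v) := by positivity
  have : ∀ h, ENNReal.ofReal (Real.exp (h * e))
        * ENNReal.ofReal (Real.exp (-(h ^ 2 / 2)) * gaussianPDFReal m v.toNNReal h)
      = ENNReal.ofReal (mixFactor e m v) * ENNReal.ofReal
          (gaussianPDFReal ((m + e * v) / (1 + v)) (v / (1 + v)).toNNReal h) := fun h => by
    rw [← ENNReal.ofReal_mul (Real.exp_pos _).le, exp_mul_gaussianPDFReal e m h hv,
      ENNReal.ofReal_mul (by exact (Real.exp_pos _).le)]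
  simp_rw [this]
  rw [lintegral_const_mul _ (measurable_gaussianPDFReal _ _).ennreal_ofReal,
    lintegral_gaussianPDFReal_eq_one _ (by simpa using h2), mul_one]

variable {Ω : Type*} {mΩ : MeasurableSpace Ω} {P : Measure Ω} [IsProbabilityMeasure P]

/-- A bound on a conditional expectation holds after integration against a nonnegative
function measurable with respect to the conditioning `σ`-algebra. -/
theorem lintegral_mul_le_of_condExp_le {m : MeasurableSpace Ω} (hm : m ≤ mΩ) {F : Ω → ℝ}
    (hF : Integrable F P) (hF0 : 0 ≤ F) {c : ℝ} (hle : P[F | m] ≤ᵐ[P] fun _ => c)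
    {g : Ω → ℝ≥0∞} (hg : Measurable[m] g) :
    ∫⁻ ω, g ω * ENNReal.ofReal (F ω) ∂P ≤ ENNReal.ofReal c * ∫⁻ ω, g ω ∂P := by
  have hFm : AEMeasurable (fun ω => ENNReal.ofReal (F ω)) P := hF.aemeasurable.ennreal_ofReal
  have hset : ∀ s, MeasurableSet[m] s →
      ∫⁻ ω in s, ENNReal.ofReal (F ω) ∂P ≤ ENNReal.ofReal c * P s := fun s hs => by
    rw [← ofReal_integral_eq_lintegral_ofReal hF.restrict (ae_of_all _ hF0),
      ← setIntegral_condExp hm hF hs]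
    have h1 : ∫ ω in s, (P[F | m]) ω ∂P ≤ ∫ _ in s, c ∂P :=
      integral_mono_ae integrable_condExp.restrict (integrable_const c) (ae_restrict_of_ae hle)
    refine (ENNReal.ofReal_le_ofReal h1).trans ?_
    rw [setIntegral_const, smul_eq_mul, mul_comm]
    rcases le_or_gt 0 c with hc | hc
    · rw [ENNReal.ofReal_mul hc, measureReal_def, ENNReal.ofReal_toReal (measure_ne_top _ _)]
    · rw [ENNReal.ofReal_of_nonpos (mul_nonpos_of_nonpos_of_nonneg hc.le measureReal_nonneg)]
      exact zero_le
  -- Comparing measures on the smaller `σ`-algebra admits every measurable `g`, with no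
  -- integrability required.
  have hν : (P.withDensity fun ω => ENNReal.ofReal (F ω)).trim hm
      ≤ ENNReal.ofReal c • P.trim hm := by
    refine Measure.le_iff.2 fun s hs => ?_
    rw [trim_measurableSet_eq hm hs, withDensity_apply _ (hm s hs), Measure.smul_apply,
      trim_measurableSet_eq hm hs, smul_eq_mul]
    exact hset s hs
  calc ∫⁻ ω, g ω * ENNReal.ofReal (F ω) ∂P
      = ∫⁻ ω, g ω ∂(P.withDensity fun ω => ENNReal.ofReal (F ω)) := by
        rw [lintegral_withDensity_eq_lintegral_mul₀ hFm (hg.mono hm le_rfl).aemeasurable]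
        simp only [Pi.mul_apply, mul_comm]
    _ = ∫⁻ ω, g ω ∂((P.withDensity fun ω => ENNReal.ofReal (F ω)).trim hm) :=
        (lintegral_trim hm hg).symm
    _ ≤ ∫⁻ ω, g ω ∂(ENNReal.ofReal c • P.trim hm) := lintegral_mono' hν le_rfl
    _ = _ := by rw [lintegral_smul_measure, lintegral_trim hm hg, smul_eq_mul]

/-- Mixing exponential tilts of conditionally sub-Gaussian noise over a predictable Gaussian prior
does not increase expectations. -/
theorem lintegral_mul_mixFactor_le {Ω : Type*} {m₀ mΩ : MeasurableSpace Ω} {P : Measure Ω}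
    [IsProbabilityMeasure P] (hm₀ : m₀ ≤ mΩ) {e : Ω → ℝ}
    (he : Measurable e)
    (hsub : ∀ η : ℝ, Integrable (fun ω => Real.exp (η * e ω)) P ∧
      P[fun ω => Real.exp (η * e ω) | m₀] ≤ᵐ[P] fun _ => Real.exp (η ^ 2 / 2))
    {m v : Ω → ℝ} (hm : Measurable[m₀] m) (hv : Measurable[m₀] v) (hv0 : ∀ ω, 0 ≤ v ω)
    (hmv : ∀ ω, v ω = 0 → m ω = 0) {g : Ω → ℝ≥0∞} (hg : Measurable[m₀] g) :
    ∫⁻ ω, g ω * ENNReal.ofReal (mixFactor (e ω) (m ω) (v ω)) ∂P ≤ ∫⁻ ω, g ω ∂P := by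
  -- The prior has a density only where `v` is positive. Off `A` the mean also vanishes and the
  -- factor is $1$.
  set A : Set Ω := {ω | 0 < v ω} with hA
  have hAm₀ : MeasurableSet[m₀] A := measurableSet_lt measurable_const hv
  have hAm : MeasurableSet A := hm₀ _ hAm₀
  have hgΩ : Measurable g := hg.mono hm₀ le_rfl
  have hmΩ : Measurable m := hm.mono hm₀ le_rfl
  have hvΩ : Measurable v := hv.mono hm₀ le_rfl
  rw [← lintegral_add_compl _ hAm, ← lintegral_add_compl (fun ω => g ω) hAm]
  refine add_le_add ?_ (le_of_eq ?_)
  · have hgA : Measurable[m₀] (A.indicator g) := hg.indicator hAm₀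
    have hgAΩ : Measurable (A.indicator g) := hgΩ.indicator hAm
    have hpdf : Measurable fun q : Ω × ℝ => gaussianPDFReal (m q.1) (v q.1).toNNReal q.2 :=
      measurable_uncurry_gaussianPDFReal.comp
        ((hmΩ.comp measurable_fst).prodMk
          ((hvΩ.comp measurable_fst).real_toNNReal.prodMk measurable_snd))
    have hpdf₀ : ∀ h : ℝ, Measurable[m₀] fun ω => gaussianPDFReal (m ω) (v ω).toNNReal h :=
      fun h => measurable_uncurry_gaussianPDFReal.comp
        (hm.prodMk (hv.real_toNNReal.prodMk measurable_const))
    have hexp : Measurable fun q : Ω × ℝ => Real.exp (-(q.2 ^ 2 / 2)) := by fun_prop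
    have hexpe : Measurable fun q : Ω × ℝ => Real.exp (q.2 * e q.1) := by fun_prop
    calc ∫⁻ ω in A, g ω * ENNReal.ofReal (mixFactor (e ω) (m ω) (v ω)) ∂P
        = ∫⁻ ω, A.indicator g ω * ENNReal.ofReal (mixFactor (e ω) (m ω) (v ω)) ∂P := by
          rw [← lintegral_indicator hAm]
          refine lintegral_congr fun ω => ?_
          by_cases h : ω ∈ A <;> simp [h]
      _ = ∫⁻ ω, ∫⁻ h, A.indicator g ω * (ENNReal.ofReal (Real.exp (h * e ω))
            * ENNReal.ofReal (Real.exp (-(h ^ 2 / 2))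
              * gaussianPDFReal (m ω) (v ω).toNNReal h)) ∂volume ∂P := by
          refine lintegral_congr fun ω => ?_
          rw [lintegral_const_mul]
          · by_cases h : ω ∈ A
            · rw [lintegral_exp_mul_gaussianPDFReal _ _ h]
            · simp [h]
          · exact (by fun_prop : Measurable fun h : ℝ => ENNReal.ofReal (Real.exp (h * e ω))).mul
              (((by fun_prop : Measurable fun h : ℝ => Real.exp (-(h ^ 2 / 2))).mul
                (measurable_gaussianPDFReal _ _)).ennreal_ofReal)
      _ = ∫⁻ h, ∫⁻ ω, A.indicator g ω * (ENNReal.ofReal (Real.exp (h * e ω))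
            * ENNReal.ofReal (Real.exp (-(h ^ 2 / 2))
              * gaussianPDFReal (m ω) (v ω).toNNReal h)) ∂P :=
          lintegral_lintegral_swap ((hgAΩ.comp measurable_fst).mul
            (hexpe.ennreal_ofReal.mul (hexp.mul hpdf).ennreal_ofReal)).aemeasurable
      _ ≤ ∫⁻ h, ∫⁻ ω, A.indicator g ω * ENNReal.ofReal
            (gaussianPDFReal (m ω) (v ω).toNNReal h) ∂P := by
          refine lintegral_mono fun h => ?_
          have hq : Measurable[m₀] fun ω => A.indicator g ω * ENNReal.ofReal
              (Real.exp (-(h ^ 2 / 2)) * gaussianPDFReal (m ω) (v ω).toNNReal h) :=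
            hgA.mul (((hpdf₀ h).const_mul _).ennreal_ofReal)
          have := lintegral_mul_le_of_condExp_le hm₀ (hsub h).1
            (fun ω => (Real.exp_pos _).le) (hsub h).2 hq
          calc _ = ∫⁻ ω, A.indicator g ω * ENNReal.ofReal (Real.exp (-(h ^ 2 / 2))
                * gaussianPDFReal (m ω) (v ω).toNNReal h)
                * ENNReal.ofReal (Real.exp (h * e ω)) ∂P :=
              lintegral_congr fun ω => by ring
            _ ≤ _ := this
            _ = _ := by
              rw [← lintegral_const_mul _ (hq.mono hm₀ le_rfl)]
              refine lintegral_congr fun ω => ?_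
              rw [ENNReal.ofReal_mul (Real.exp_pos _).le]
              have h1 : ENNReal.ofReal (Real.exp (h ^ 2 / 2))
                  * ENNReal.ofReal (Real.exp (-(h ^ 2 / 2))) = 1 := by
                rw [← ENNReal.ofReal_mul (Real.exp_pos _).le, ← Real.exp_add]; simp
              calc _ = (ENNReal.ofReal (Real.exp (h ^ 2 / 2))
                    * ENNReal.ofReal (Real.exp (-(h ^ 2 / 2)))) * (A.indicator g ω
                      * ENNReal.ofReal (gaussianPDFReal (m ω) (v ω).toNNReal h)) := by ring
                _ = _ := by rw [h1, one_mul]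
      _ = ∫⁻ ω, ∫⁻ h, A.indicator g ω * ENNReal.ofReal
            (gaussianPDFReal (m ω) (v ω).toNNReal h) ∂volume ∂P :=
          (lintegral_lintegral_swap ((hgAΩ.comp measurable_fst).mul
            hpdf.ennreal_ofReal).aemeasurable).symm
      _ = ∫⁻ ω, A.indicator g ω ∂P := by
          refine lintegral_congr fun ω => ?_
          rw [lintegral_const_mul _ (measurable_gaussianPDFReal _ _).ennreal_ofReal]
          by_cases h : ω ∈ A
          · rw [lintegral_gaussianPDFReal_eq_one _ (by simpa [hA] using h), mul_one]
          · simp [h]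
      _ = ∫⁻ ω in A, g ω ∂P := lintegral_indicator hAm _
  · refine setLIntegral_congr_fun hAm.compl fun ω hω => ?_
    have h0 : v ω = 0 := le_antisymm (not_lt.1 hω) (hv0 ω)
    simp [mixFactor, h0, hmv ω h0]

/-- The maximal inequality for a product of factors each of which does not increase expectations
given the past. -/
theorem mul_measure_exists_le_prod (ℱ : Filtration ℕ mΩ) {F : ℕ → Ω → ℝ} {T : ℕ}
    (hF0 : ∀ n ω, 0 ≤ F n ω) (hF : ∀ n < T, Measurable[ℱ (n + 1)] (F n))
    (hle : ∀ n < T, ∀ g : Ω → ℝ≥0∞, Measurable[ℱ n] g →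
      ∫⁻ ω, g ω * ENNReal.ofReal (F n ω) ∂P ≤ ∫⁻ ω, g ω ∂P) (c : ℝ) :
    ENNReal.ofReal c * P {ω | ∃ n ≤ T, c ≤ ∏ i ∈ Finset.range n, F i ω} ≤ 1 := by
  set S : ℕ → Ω → ℝ := fun n ω => ∏ i ∈ Finset.range n, F i ω with hS
  have hSm : ∀ n ≤ T, Measurable[ℱ n] (S n) := fun n hn => by
    refine Finset.measurable_fun_prod _ fun i hi => ?_
    have hi' := Finset.mem_range.1 hi
    exact (hF i (by omega)).mono (ℱ.mono (by omega)) le_rfl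
  set C : ℕ → Set Ω := fun n => {ω | ∃ i ≤ n, c ≤ S i ω} with hC
  have hCm : ∀ n ≤ T, MeasurableSet[ℱ n] (C n) := fun n hn => by
    have : C n = ⋃ i ∈ Finset.range (n + 1), {ω | c ≤ S i ω} := by
      ext ω; simp [hC]
    rw [this]
    refine Finset.measurableSet_biUnion _ fun i hi => ?_
    have hi' := Finset.mem_range.1 hi
    exact measurableSet_le measurable_const
      ((hSm i (by omega)).mono (ℱ.mono (by omega)) le_rfl)
  -- The process frozen at level `c` on first crossing: its mean never exceeds $1$. Newly crossing
  -- mass moves to the first term, and `hle` is applied off `C n`, which is known at time `n`.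
  have key : ∀ n ≤ T, ENNReal.ofReal c * P (C n) + ∫⁻ ω in (C n)ᶜ, ENNReal.ofReal (S n ω) ∂P
      ≤ 1 := by
    intro n
    induction n with
    | zero =>
      intro _
      by_cases h : c ≤ 1
      · have hu : C 0 = Set.univ := by ext ω; simp [hC, hS, h]
        rw [hu]
        simpa using h
      · have hu : C 0 = ∅ := by ext ω; simpa [hC, hS] using h
        rw [hu]
        simp [hS]
    | succ n ih =>
      intro hn
      refine le_trans ?_ (ih (by omega))
      have hsub : C n ⊆ C (n + 1) := fun ω ⟨i, hi, h⟩ => ⟨i, by omega, h⟩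
      have hmn : MeasurableSet (C n) := ℱ.le n _ (hCm n (by omega))
      have hmn1 : MeasurableSet (C (n + 1)) := ℱ.le (n + 1) _ (hCm (n + 1) hn)
      set D := C (n + 1) \ C n with hD
      have hDm : MeasurableSet D := hmn1.diff hmn
      have hSΩ : Measurable (S (n + 1)) := (hSm _ hn).mono (ℱ.le _) le_rfl
      have h1 : P (C (n + 1)) = P (C n) + P D := by
        rw [hD, ← measure_union Set.disjoint_sdiff_right hDm, Set.union_sdiff_cancel hsub]
      have hDc : ENNReal.ofReal c * P D ≤ ∫⁻ ω in D, ENNReal.ofReal (S (n + 1) ω) ∂P := by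
        rw [← setLIntegral_const]
        refine setLIntegral_mono hSΩ.ennreal_ofReal fun ω hω => ENNReal.ofReal_le_ofReal ?_
        obtain ⟨⟨i, hi, h⟩, h2⟩ := hω
        rcases Nat.lt_or_ge n i with h3 | h3
        · have : i = n + 1 := by omega
          rwa [this] at h
        · exact absurd ⟨i, h3, h⟩ h2
      have hun : (C n)ᶜ = D ∪ (C (n + 1))ᶜ := by
        ext ω
        by_cases h : ω ∈ C n
        · simp [hD, h, hsub h]
        · by_cases h' : ω ∈ C (n + 1) <;> simp [hD, h, h']
      have hdisj : Disjoint D (C (n + 1))ᶜ :=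
        Set.disjoint_left.2 fun ω h1 h2 => h2 h1.1
      have hstep : ∫⁻ ω in (C n)ᶜ, ENNReal.ofReal (S (n + 1) ω) ∂P
          ≤ ∫⁻ ω in (C n)ᶜ, ENNReal.ofReal (S n ω) ∂P := by
        rw [← lintegral_indicator hmn.compl, ← lintegral_indicator hmn.compl]
        have hgm : Measurable[ℱ n] ((C n)ᶜ.indicator fun ω => ENNReal.ofReal (S n ω)) :=
          (hSm n (by omega)).ennreal_ofReal.indicator (hCm n (by omega)).compl
        refine le_trans (le_of_eq ?_) (hle n (by omega) _ hgm)
        refine lintegral_congr fun ω => ?_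
        by_cases h : ω ∈ (C n)ᶜ
        · rw [Set.indicator_of_mem h, Set.indicator_of_mem h, ← ENNReal.ofReal_mul
            (Finset.prod_nonneg fun i _ => hF0 i ω)]
          simp only [hS, Finset.prod_range_succ]
        · rw [Set.indicator_of_notMem h, Set.indicator_of_notMem h, zero_mul]
      calc _ = ENNReal.ofReal c * P (C n) + (ENNReal.ofReal c * P D
            + ∫⁻ ω in (C (n + 1))ᶜ, ENNReal.ofReal (S (n + 1) ω) ∂P) := by
            rw [h1, mul_add, add_assoc]
        _ ≤ ENNReal.ofReal c * P (C n) + (∫⁻ ω in D, ENNReal.ofReal (S (n + 1) ω) ∂P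
            + ∫⁻ ω in (C (n + 1))ᶜ, ENNReal.ofReal (S (n + 1) ω) ∂P) := by gcongr
        _ = ENNReal.ofReal c * P (C n) + ∫⁻ ω in (C n)ᶜ, ENNReal.ofReal (S (n + 1) ω) ∂P := by
            rw [hun, lintegral_union hmn1.compl hdisj]
        _ ≤ _ := by gcongr
  exact le_self_add.trans (key T le_rfl)

end Mixture

/-! ### Measurability of the posterior quantities. -/

section Measurability

variable {Ω : Type*} {m₀ : MeasurableSpace Ω} {n : ℕ}

theorem measurable_matrix_det {M : Ω → Matrix (Fin n) (Fin n) ℝ}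
    (h : ∀ i j, Measurable fun ω => M ω i j) : Measurable fun ω => (M ω).det := by
  simp only [Matrix.det_apply']
  exact Finset.measurable_fun_sum _ fun p _ =>
    (Finset.measurable_fun_prod _ fun i _ => h _ _).const_mul _

theorem measurable_matrix_inv_apply {M : Ω → Matrix (Fin n) (Fin n) ℝ}
    (h : ∀ i j, Measurable fun ω => M ω i j) (i j : Fin n) :
    Measurable fun ω => (M ω)⁻¹ i j := by
  simp only [Matrix.inv_def, Matrix.smul_apply, Ring.inverse_eq_inv', smul_eq_mul,
    Matrix.adjugate_apply]
  refine (measurable_matrix_det h).inv.mul (measurable_matrix_det fun i' j' => ?_)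
  by_cases hj : i' = j
  · subst hj; simp
  · simpa [Matrix.updateRow_ne hj] using h i' j'

variable {𝒳 : Type*} [TopologicalSpace 𝒳] [SecondCountableTopology 𝒳] [MeasurableSpace 𝒳]
  [OpensMeasurableSpace 𝒳] {k : 𝒳 → 𝒳 → ℝ} {σ : ℝ} {a : Fin n → Ω → 𝒳} {y : Fin n → Ω → ℝ}
  {z : Ω → 𝒳}

theorem measurable_kernel_comp (hk : Continuous fun q : 𝒳 × 𝒳 => k q.1 q.2) {u w : Ω → 𝒳}
    (hu : Measurable u) (hw : Measurable w) : Measurable fun ω => k (u ω) (w ω) :=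
  hk.measurable.comp (hu.prodMk hw)

theorem measurable_regGram_inv (hk : Continuous fun q : 𝒳 × 𝒳 => k q.1 q.2)
    (ha : ∀ i, Measurable (a i)) (i j : Fin n) :
    Measurable fun ω => (regGram k σ fun i => a i ω)⁻¹ i j :=
  measurable_matrix_inv_apply (fun i j => (measurable_kernel_comp hk (ha i) (ha j)).add_const _) i j

theorem measurable_postMean (hk : Continuous fun q : 𝒳 × 𝒳 => k q.1 q.2)
    (ha : ∀ i, Measurable (a i)) (hy : ∀ i, Measurable (y i)) (hz : Measurable z) :
    Measurable fun ω => postMean k σ (fun i => a i ω) (fun i => y i ω) (z ω) := by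
  simp only [postMean_eq, dotProduct, Matrix.mulVec, kvec]
  exact Finset.measurable_fun_sum _ fun i _ => (measurable_kernel_comp hk (ha i) hz).mul
    (Finset.measurable_fun_sum _ fun j _ => (measurable_regGram_inv hk ha i j).mul (hy j))

theorem measurable_postVar (hk : Continuous fun q : 𝒳 × 𝒳 => k q.1 q.2)
    (ha : ∀ i, Measurable (a i)) (hz : Measurable z) :
    Measurable fun ω => postVar k σ (fun i => a i ω) (z ω) := by
  simp only [postVar_eq]
  exact (measurable_kernel_comp hk hz hz).sub
    (measurable_postMean hk ha (fun i => measurable_kernel_comp hk (ha i) hz) hz)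

end Measurability

/-! ### Finiteness of the information gain and of the covering number. -/

section Family

variable {𝒳 H : Type*} {σ : ℝ}

/-- A crude Leibniz bound on the determinant. Only its uniformity matters: it makes the real suprema
in `familyInfoGain` genuine instead of the default $0$. -/
theorem IsKernel.infoGain_le {k : 𝒳 → 𝒳 → ℝ} (hk : IsKernel k) (hk1 : ∀ x x', k x x' ≤ 1)
    (hσ : 1 ≤ σ) {n : ℕ} (a : Fin n → 𝒳) :
    infoGain k σ a ≤ 1 / 2 * Real.log (n.factorial * 2 ^ n) := by
  have hσ0 : 0 < σ := by linarith
  have hinv : (σ ^ 2)⁻¹ ≤ 1 := inv_le_one_of_one_le₀ (by nlinarith)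
  have hpos : 0 < (1 + (σ ^ 2)⁻¹ • gram k a).det :=
    (Matrix.PosDef.one.add_posSemidef ((hk.posSemidef_gram a).smul
      (by positivity : (0 : ℝ) ≤ (σ ^ 2)⁻¹))).det_pos
  have hent : ∀ i j, AbsoluteValue.abs ((1 + (σ ^ 2)⁻¹ • gram k a) i j) ≤ (2 : ℝ) := fun i j => by
    have h1 : |(1 : Matrix (Fin n) (Fin n) ℝ) i j| ≤ 1 := by
      rw [Matrix.one_apply]; split_ifs <;> simp
    have h2 : |(σ ^ 2)⁻¹ * k (a i) (a j)| ≤ 1 := by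
      rw [abs_mul, abs_of_nonneg (by positivity : (0 : ℝ) ≤ (σ ^ 2)⁻¹)]
      exact mul_le_one₀ hinv (abs_nonneg _) (hk.abs_le_one hk1 _ _)
    calc |(1 : Matrix (Fin n) (Fin n) ℝ) i j + (σ ^ 2)⁻¹ * k (a i) (a j)| ≤ _ := abs_add_le _ _
      _ ≤ 2 := by linarith
  have := Matrix.det_le hent
  rw [Fintype.card_fin, nsmul_eq_mul] at this
  rw [infoGain]
  gcongr
  exact (le_abs_self _).trans this

theorem infoGain_le_familyInfoGain {k : H → 𝒳 → 𝒳 → ℝ} (hk : ∀ θ, IsKernel (k θ))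
    (hk1 : ∀ θ x x', k θ x x' ≤ 1) (hσ : 1 ≤ σ) {n : ℕ} (θ : H) (a : Fin n → 𝒳) :
    infoGain (k θ) σ a ≤ familyInfoGain k σ n := by
  have hb : ∀ θ (a : Fin n → 𝒳), infoGain (k θ) σ a ≤ 1 / 2 * Real.log (n.factorial * 2 ^ n) :=
    fun θ a => (hk θ).infoGain_le (hk1 θ) hσ a
  have h1 : infoGain (k θ) σ a ≤ maxInfoGain (k θ) σ n :=
    le_ciSup (f := fun a : Fin n → 𝒳 => infoGain (k θ) σ a)
      ⟨_, Set.forall_mem_range.2 fun a => hb θ a⟩ a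
  have : Nonempty (Fin n → 𝒳) := ⟨a⟩
  exact h1.trans (le_ciSup (f := fun θ => maxInfoGain (k θ) σ n)
    ⟨_, Set.forall_mem_range.2 fun θ => ciSup_le fun a => hb θ a⟩ θ)

theorem familyInfoGain_nonneg {k : H → 𝒳 → 𝒳 → ℝ} (hk : ∀ θ, IsKernel (k θ))
    (hk1 : ∀ θ x x', k θ x x' ≤ 1) (hσ : 1 ≤ σ) (θ : H) (z : 𝒳) (n : ℕ) :
    0 ≤ familyInfoGain k σ n :=
  ((hk θ).infoGain_nonneg (by linarith) (fun _ => z) n).trans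
    (infoGain_le_familyInfoGain hk hk1 hσ θ _)

theorem abs_sub_le_kernelDist {k k' : 𝒳 → 𝒳 → ℝ} (hk : IsKernel k) (hk' : IsKernel k')
    (hk1 : ∀ x x', k x x' ≤ 1) (hk1' : ∀ x x', k' x x' ≤ 1) (x x' : 𝒳) :
    |k x x' - k' x x'| ≤ kernelDist k k' := by
  refine le_ciSup (f := fun q : 𝒳 × 𝒳 => |k q.1 q.2 - k' q.1 q.2|)
    ⟨2, Set.forall_mem_range.2 fun q => ?_⟩ (x, x')
  have h1 := hk.abs_le_one hk1 q.1 q.2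
  have h2 := hk'.abs_le_one hk1' q.1 q.2
  rw [abs_le] at *
  constructor <;> linarith

/-- The curried family is continuous into $C(\mathcal X\times\mathcal X)$, so compactness yields a
finite cover; the infimum of a nonempty set of naturals is attained. -/
theorem exists_cover_card_eq [TopologicalSpace 𝒳] [TopologicalSpace H] [CompactSpace 𝒳]
    [CompactSpace H] {k : H → 𝒳 → 𝒳 → ℝ}
    (hk : Continuous fun q : H × 𝒳 × 𝒳 => k q.1 q.2.1 q.2.2) {ε : ℝ} (hε : 0 < ε) :
    ∃ s : Finset H, s.card = coveringNumber k ε ∧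
      ∀ θ, ∃ θ' ∈ s, kernelDist (k θ) (k θ') ≤ ε := by
  refine Nat.sInf_mem (s := {N : ℕ | ∃ s : Finset H, s.card = N ∧
    ∀ θ, ∃ θ' ∈ s, kernelDist (k θ) (k θ') ≤ ε}) ?_
  let F : C(H, C(𝒳 × 𝒳, ℝ)) := ContinuousMap.curry ⟨fun q : H × 𝒳 × 𝒳 => k q.1 q.2.1 q.2.2, hk⟩
  obtain ⟨t, ht⟩ := CompactSpace.elim_nhds_subcover (fun θ => F ⁻¹' Metric.ball (F θ) ε)
    fun θ => F.continuous.continuousAt.preimage_mem_nhds (Metric.ball_mem_nhds _ hε)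
  refine ⟨t.card, t, rfl, fun θ => ?_⟩
  have hθ : θ ∈ ⋃ x ∈ t, F ⁻¹' Metric.ball (F x) ε := by rw [ht]; trivial
  simp only [Set.mem_iUnion, Set.mem_preimage, Metric.mem_ball] at hθ
  obtain ⟨θ', hθ', hd⟩ := hθ
  refine ⟨θ', hθ', Real.iSup_le (fun q => ?_) hε.le⟩
  exact (ContinuousMap.dist_apply_le_dist (f := F θ) (g := F θ') q).trans hd.le

end Family

/-! ### Probabilities of the exceptional events. -/

section Events

variable {Ω : Type*} {mΩ : MeasurableSpace Ω} {P : Measure Ω} {ℱ : Filtration ℕ mΩ}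
  {ε : ℕ → Ω → ℝ} {R : ℝ} {T : ℕ}

theorem CondSubGaussian.div (hR : 0 < R) (hsub : CondSubGaussian P ℱ ε R T) {n : ℕ} (hn : n < T)
    (η : ℝ) : Integrable (fun ω => Real.exp (η * (ε n ω / R))) P ∧
      P[fun ω => Real.exp (η * (ε n ω / R)) | ℱ n] ≤ᵐ[P] fun _ => Real.exp (η ^ 2 / 2) := by
  have h := hsub n hn (η / R)
  have h1 : (fun ω => Real.exp (η / R * ε n ω)) = fun ω => Real.exp (η * (ε n ω / R)) := by
    funext ω; congr 1; ring
  have h2 : (η / R) ^ 2 * R ^ 2 / 2 = η ^ 2 / 2 := by field_simp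
  rwa [h1, h2] at h

variable [IsProbabilityMeasure P]

/-- The maximal inequality for products of mixture factors with a predictable prior. -/
theorem measure_exists_le_prod_mixFactor (hR : 0 < R)
    (hε : ∀ n < T, Measurable[ℱ (n + 1)] (ε n)) (hsub : CondSubGaussian P ℱ ε R T)
    {m v : ℕ → Ω → ℝ} (hm : ∀ n < T, Measurable[ℱ n] (m n)) (hv : ∀ n < T, Measurable[ℱ n] (v n))
    (hv0 : ∀ n ω, 0 ≤ v n ω) (hmv : ∀ n ω, v n ω = 0 → m n ω = 0) {c : ℝ} (hc : 0 < c) :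
    P {ω | ∃ n ≤ T, c ≤ ∏ i ∈ Finset.range n, mixFactor (ε i ω / R) (m i ω) (v i ω)}
      ≤ ENNReal.ofReal c⁻¹ := by
  have h := mul_measure_exists_le_prod (P := P) ℱ
    (F := fun n ω => mixFactor (ε n ω / R) (m n ω) (v n ω)) (T := T)
    (fun n ω => (Real.exp_pos _).le)
    (fun n hn => measurable_mixFactor ((hε n hn).div_const R)
      ((hm n hn).mono (ℱ.mono (by omega)) le_rfl) ((hv n hn).mono (ℱ.mono (by omega)) le_rfl))
    (fun n hn g hg => lintegral_mul_mixFactor_le (ℱ.le n)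
      (((hε n hn).mono (ℱ.le _) le_rfl).div_const R) (fun η => hsub.div hR hn η)
      (hm n hn) (hv n hn) (hv0 n) (hmv n) hg) c
  rw [ENNReal.ofReal_inv_of_pos hc]
  rw [mul_comm] at h
  exact ENNReal.le_inv_iff_mul_le.2 h

theorem measure_exists_le_exp_fitQuad {𝒳 : Type*} [TopologicalSpace 𝒳]
    [SecondCountableTopology 𝒳] [MeasurableSpace 𝒳] [OpensMeasurableSpace 𝒳] {k : 𝒳 → 𝒳 → ℝ}
    {σ : ℝ} (hk : IsKernel k) (hkc : Continuous fun q : 𝒳 × 𝒳 => k q.1 q.2) (hσ : 0 < σ)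
    (hR : 0 < R) {x : ℕ → Ω → 𝒳} (hx : ∀ n < T, Measurable[ℱ n] (x n))
    (hε : ∀ n < T, Measurable[ℱ (n + 1)] (ε n)) (hsub : CondSubGaussian P ℱ ε R T)
    {c : ℝ} (hc : 0 < c) :
    P {ω | ∃ n ≤ T, c ≤ Real.exp (fitQuad k σ (fun i : Fin n => x i ω) (fun i => ε i ω / R) / 2
        - infoGain k σ (fun i : Fin n => x i ω))} ≤ ENNReal.ofReal c⁻¹ := by
  have hxm : ∀ n < T, ∀ i ≤ n, Measurable[ℱ n] (x i) := fun n hn i hi =>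
    (hx i (by omega)).mono (ℱ.mono hi) le_rfl
  have h := measure_exists_le_prod_mixFactor hR hε hsub
    (m := fun n ω => postMean k σ (fun j : Fin n => x j ω) (fun j => ε j ω / R) (x n ω))
    (v := fun n ω => postVar k σ (fun j : Fin n => x j ω) (x n ω) / σ ^ 2)
    (fun n hn => measurable_postMean (a := fun j : Fin n => x j)
      (y := fun (j : Fin n) ω => ε j ω / R) hkc (fun i => hxm n hn i i.2.le)
      (fun i => ((hε i (i.2.trans hn)).mono (ℱ.mono i.2) le_rfl).div_const R) (hxm n hn n le_rfl))
    (fun n hn => (measurable_postVar (a := fun j : Fin n => x j) hkc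
      (fun i => hxm n hn i i.2.le) (hxm n hn n le_rfl)).div_const _)
    (fun n ω => div_nonneg (hk.postVar_nonneg hσ _ _) (sq_nonneg σ))
    (fun n ω h => hk.postMean_eq_zero hσ _ _ _
      ((div_eq_zero_iff.1 h).resolve_right (by positivity))) hc
  refine le_trans (le_of_eq ?_) h
  congr 1
  ext ω
  simp only [Set.mem_ofPred_eq]
  refine exists_congr fun n => and_congr_right fun _ => ?_
  rw [← hk.prod_mixFactor hσ (fun i => x i ω) (fun i => ε i ω / R) n]

/-- The mixture with the constant prior $N(0,v)$. Larger `v` brings the coefficient $v/(1+v)$ closer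
to $1$, at the cost of a larger $\log(1+v)$ per round. -/
theorem measure_exists_le_exp_sum_sq (hR : 0 < R)
    (hε : ∀ n < T, Measurable[ℱ (n + 1)] (ε n)) (hsub : CondSubGaussian P ℱ ε R T)
    {v : ℝ} (hv : 0 ≤ v) {c : ℝ} (hc : 0 < c) :
    P {ω | ∃ n ≤ T, c ≤ Real.exp (v / (1 + v) / 2 * ∑ i ∈ Finset.range n, (ε i ω / R) ^ 2
        - n * (Real.log (1 + v) / 2))} ≤ ENNReal.ofReal c⁻¹ := by
  have h := measure_exists_le_prod_mixFactor hR hε hsub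
    (m := fun _ _ => 0) (v := fun _ _ => v) (fun n _ => measurable_const)
    (fun n _ => measurable_const) (fun _ _ => hv) (fun _ _ _ => rfl) hc
  refine le_trans (le_of_eq ?_) h
  congr 1
  ext ω
  simp only [Set.mem_ofPred_eq]
  refine exists_congr fun n => and_congr_right fun _ => ?_
  have : ∏ i ∈ Finset.range n, mixFactor (ε i ω / R) 0 v
      = Real.exp (v / (1 + v) / 2 * ∑ i ∈ Finset.range n, (ε i ω / R) ^ 2
        - n * (Real.log (1 + v) / 2)) := by
    simp only [mixFactor]
    rw [← Real.exp_sum]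
    congr 1
    rw [Finset.sum_sub_distrib, Finset.sum_const, Finset.card_range, nsmul_eq_mul, Finset.mul_sum]
    congr 1
    refine Finset.sum_congr rfl fun i _ => ?_
    have : 1 + v ≠ 0 := by positivity
    field_simp
    ring
  rw [this]

end Events

/-! ### Numerical estimates on the good event. -/

section Deterministic

theorem fitQuad_smul {𝒳 : Type*} {k : 𝒳 → 𝒳 → ℝ} {σ : ℝ} {n : ℕ} (a : Fin n → 𝒳)
    (e : Fin n → ℝ) (r : ℝ) : fitQuad k σ a (fun i => r * e i) = r ^ 2 * fitQuad k σ a e := by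
  have : (fun i => r * e i) = r • e := rfl
  rw [this]
  simp only [fitQuad, invQuad, Matrix.mulVec_smul, dotProduct_smul, smul_dotProduct, smul_eq_mul]
  ring

/-- The noise term at an arbitrary parameter is controlled, through the norm of the noise, either by
the crude bound `q ≤ n / (n + l) * W` or by the noise term `q'` of a nearby centre. -/
theorem noise_le_of_norm_le {t n W L l q q' Q : ℝ} (ht : 2 ≤ t) (hn : 0 ≤ n) (hnt : n ≤ t - 1)
    (hW : 0 ≤ W) (hL : 0 ≤ L) (hl : 1 ≤ l) (hQ : L ≤ Q)
    (hnorm : (2 * t - 1) / (2 * t) / 2 * W - n * (Real.log (2 * t) / 2) < L + Real.log 2)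
    (hcrude : q ≤ n / (n + l) * W) (hnear : q ≤ q' + (t ^ 4)⁻¹ * n * W / l)
    (hq' : q' ≤ 2 * Q) : q ≤ 2 * (Q + 1) := by
  have hlog2 : Real.log 2 ≤ 7 / 10 := by linarith [Real.log_two_lt_d9]
  have hlogt : Real.log (2 * t) ≤ t := by
    rw [Real.log_mul (by norm_num) (by positivity)]
    linarith [Real.log_le_sub_one_of_pos (show 0 < t by linarith)]
  have ht0 : 0 < t := by linarith
  have hnorm' : (2 * t - 1) * W ≤ 4 * t * (t * (t - 1) / 2 + L + 7 / 10) := by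
    have h1 : n * (Real.log (2 * t) / 2) ≤ (t - 1) * (t / 2) := by
      have : 0 ≤ Real.log (2 * t) := Real.log_nonneg (by linarith)
      gcongr
      linarith
    have h2 : (2 * t - 1) / (2 * t) / 2 * W = (2 * t - 1) * W / (4 * t) := by
      field_simp; ring
    have h3 : (2 * t - 1) * W / (4 * t) ≤ t * (t - 1) / 2 + L + 7 / 10 := by
      rw [← h2]; linarith
    rw [div_le_iff₀ (by positivity)] at h3
    linarith
  -- For large `L` the crude bound wins because $\frac{t-1}{t}\cdot\frac{2t}{2t-1}<1$. Below the
  -- threshold, $t(t-1)/2+L\le t^2(t-1)$, so $nW\le2t^4$ and the perturbation is at most $2$.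
  rcases le_total (t * (t - 1) * (2 * t - 1) / 2) L with hcase | hcase
  · have h1 : n / (n + l) ≤ (t - 1) / t := by
      rw [div_le_div_iff₀ (by positivity) ht0]
      nlinarith
    have h2 : q ≤ (t - 1) / t * W := hcrude.trans (by gcongr)
    have h3 : (2 * t - 1) * ((t - 1) / t * W) ≤ (2 * t - 1) * (2 * (1 + L)) := by
      calc (2 * t - 1) * ((t - 1) / t * W) = (t - 1) / t * ((2 * t - 1) * W) := by ring
        _ ≤ (t - 1) / t * (4 * t * (t * (t - 1) / 2 + L + 7 / 10)) := by
            have : 0 ≤ (t - 1) / t := div_nonneg (by linarith) ht0.le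
            gcongr
        _ = 4 * (t - 1) * (t * (t - 1) / 2 + L + 7 / 10) := by field_simp
        _ ≤ _ := by nlinarith
    have h4 := le_of_mul_le_mul_left h3 (by linarith)
    linarith
  · have h1 : (t ^ 4)⁻¹ * n * W / l ≤ 2 := by
      have h2 : n * W ≤ 2 * t ^ 4 := by
        have h3 : (2 * t - 1) * (n * W) ≤ (2 * t - 1) * (2 * t ^ 4) := by
          calc (2 * t - 1) * (n * W) = n * ((2 * t - 1) * W) := by ring
            _ ≤ (t - 1) * (4 * t * (t * (t - 1) / 2 + L + 7 / 10)) := by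
                refine mul_le_mul hnt hnorm' (mul_nonneg (by linarith) hW) (by linarith)
            _ ≤ (t - 1) * (4 * t * (t ^ 2 * (t - 1) + 7 / 10)) := by
                have : 0 ≤ t - 1 := by linarith
                gcongr
                nlinarith
            _ ≤ _ := by
                have h4 : 2 * (t - 1) * (t ^ 2 * (t - 1) + 7 / 10) ≤ t ^ 3 * (2 * t - 1) := by
                  nlinarith [mul_nonneg (sq_nonneg t) (by linarith : (0 : ℝ) ≤ t - 2)]
                nlinarith
        exact le_of_mul_le_mul_left h3 (by linarith)
      rw [div_le_iff₀ (by linarith), mul_assoc, inv_mul_le_iff₀ (by positivity)]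
      nlinarith [pow_pos ht0 4]
    linarith

variable {𝒳 H : Type*} {k : H → 𝒳 → 𝒳 → ℝ} {σ B R δ : ℝ} {T p : ℕ}

/-- A sequence of rounds is feasible with margin `1 / 4` for `p = 2` and `1 / 8` for `p = 1` as soon
as the squared normalized prediction errors of one parameter average to at most `3 / 4`. -/
theorem marginBound_le_feasibilityMargin (hσ : 1 ≤ σ) (hT : 0 < T) (hp : p = 1 ∨ p = 2)
    (hk : ∀ θ, IsKernel (k θ)) (x : ℕ → 𝒳) (y : ℕ → ℝ) (θ : H) {b : ℝ} (hb : 0 < b)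
    (hβ : ∀ n, b ≤ betaSqrt k σ B R δ T n)
    (h : invQuad (k θ) σ (fun i : Fin T => x i) (fun i => y i) ≤ 3 / 4 * T * b ^ 2) :
    marginBound σ p ≤ feasibilityMargin k σ B R δ T p x y := by
  have hT0 : (0 : ℝ) < T := Nat.cast_pos.2 hT
  have hσ0 : 0 < σ := by linarith
  have hv : ∀ θ n, 0 < postVar (k θ) σ (fun i : Fin n => x i) (x n) + σ ^ 2 := fun θ n =>
    add_pos_of_nonneg_of_pos ((hk θ).postVar_nonneg hσ0 _ _) (by positivity)
  have hβ0 : ∀ n, 0 < betaSqrt k σ B R δ T n := fun n => hb.trans_le (hβ n)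
  -- Each negated loss is at most $1$; without an upper bound the real supremum would default to
  -- $0$.
  have hbdd : BddAbove (Set.range fun θ : H =>
      1 / (T : ℝ) * ∑ n ∈ Finset.range T, -calibLoss k σ B R δ T p x y n θ) := by
    refine ⟨1, Set.forall_mem_range.2 fun θ => ?_⟩
    have : ∑ n ∈ Finset.range T, -calibLoss k σ B R δ T p x y n θ ≤ ∑ _n ∈ Finset.range T, 1 := by
      refine Finset.sum_le_sum fun n _ => ?_
      rw [calibLoss]
      have := (hβ0 n).le
      have : 0 ≤ |y n - postMean (k θ) σ (fun i : Fin n => x i) (fun i => y i) (x n)| ^ p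
        / (betaSqrt k σ B R δ T n
          * √(postVar (k θ) σ (fun i : Fin n => x i) (x n) + σ ^ 2)) ^ p := by positivity
      linarith
    rw [Finset.sum_const, Finset.card_range, nsmul_eq_mul, mul_one] at this
    rw [one_div, inv_mul_le_iff₀ hT0]
    linarith
  refine le_trans ?_ (le_ciSup hbdd θ)
  set r : ℕ → ℝ := fun n =>
    |y n - postMean (k θ) σ (fun i : Fin n => x i) (fun i => y i) (x n)|
      / (betaSqrt k σ B R δ T n * √(postVar (k θ) σ (fun i : Fin n => x i) (x n) + σ ^ 2)) with hr
  have hcal : ∀ n, -calibLoss k σ B R δ T p x y n θ = 1 - r n ^ p := fun n => by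
    rw [calibLoss, hr, div_pow]; ring
  have hr2 : ∑ n ∈ Finset.range T, r n ^ 2 ≤ 3 / 4 * T := by
    rw [← (hk θ).sum_sq_div_eq_invQuad hσ0] at h
    have h1 : ∑ n ∈ Finset.range T, r n ^ 2 * b ^ 2 ≤ 3 / 4 * T * b ^ 2 := by
      refine le_trans (Finset.sum_le_sum fun n _ => ?_) h
      rw [hr]
      simp only [div_pow, mul_pow, sq_abs, Real.sq_sqrt (hv θ n).le]
      rw [div_mul_eq_mul_div, mul_comm (betaSqrt k σ B R δ T n ^ 2), ← div_div,
        div_le_iff₀ (by have := hβ0 n; positivity), div_mul_eq_mul_div]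
      have := hv θ n
      have := hβ n
      gcongr
    rw [← Finset.sum_mul] at h1
    exact le_of_mul_le_mul_right h1 (by positivity)
  have hsum : ∑ n ∈ Finset.range T, -calibLoss k σ B R δ T p x y n θ
      = T - ∑ n ∈ Finset.range T, r n ^ p := by
    simp only [hcal, Finset.sum_sub_distrib, Finset.sum_const, Finset.card_range, nsmul_eq_mul,
      mul_one]
  rw [hsum, one_div, le_inv_mul_iff₀ hT0, marginBound]
  rcases hp with rfl | rfl
  -- From $r\le(r^2+1)/2$ the margin is at least $1-(3/8+1/2)=1/8$, above $0.065$.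
  · have h1 : ∑ n ∈ Finset.range T, r n ^ 1 ≤ ∑ n ∈ Finset.range T, (r n ^ 2 / 2 + 1 / 2) :=
      Finset.sum_le_sum fun n _ => by nlinarith [sq_nonneg (r n - 1)]
    rw [Finset.sum_add_distrib, ← Finset.sum_div, Finset.sum_const, Finset.card_range,
      nsmul_eq_mul] at h1
    rw [if_pos rfl]
    norm_num
    norm_num at h1
    linarith
  · rw [if_neg (by norm_num)]
    have h1 : σ ^ 2 / (4 * (1 + σ ^ 2)) ≤ 1 / 4 := by
      rw [div_le_div_iff₀ (by positivity) (by norm_num)]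
      linarith
    nlinarith

theorem marginBound_pos (hσ : 1 ≤ σ) : 0 < marginBound σ p := by
  rw [marginBound]
  split_ifs
  · norm_num
  · positivity

end Deterministic

end OSCBO

end

/-! ### Assembly of the good event and the two conclusions. -/

theorem mainTheorem2
    {Ω : Type*} {mΩ : MeasurableSpace Ω} (P : Measure Ω) [IsProbabilityMeasure P]
    {d m : ℕ} (𝒳 : Set (EuclideanSpace ℝ (Fin d))) (h𝒳 : IsCompact 𝒳)
    (Θ : Set (Fin m → ℝ)) (k : Θ → 𝒳 → 𝒳 → ℝ)
    (hk : ∀ θ, IsKernel (k θ)) (hk_le : ∀ θ x x', k θ x x' ≤ 1)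
    (hk_cont : Continuous fun q : Θ × 𝒳 × 𝒳 => k q.1 q.2.1 q.2.2)
    (f : 𝒳 → ℝ) (B R σ δ : ℝ) (hB : 0 < B) (hR : 0 < R) (hσ : 1 ≤ σ)
    (hδ₀ : 0 < δ) (hδ₁ : δ < 1)
    (hf : RKHSAssumption Θ hk f B)
    (T : ℕ) (hT : 1 < T) (p : ℕ) (hp : p = 1 ∨ p = 2)
    (ℱ : Filtration ℕ mΩ) (x : ℕ → Ω → 𝒳) (ε y : ℕ → Ω → ℝ)
    (hx : ∀ n < T, Measurable[ℱ n] (x n)) (hε : ∀ n < T, Measurable[ℱ (n + 1)] (ε n))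
    (hsub : CondSubGaussian P ℱ ε R T)
    (hy : ∀ n < T, ∀ ω, y n ω = f (x n ω) + ε n ω) :
    0 < marginBound σ p ∧
    ∃ E : Set Ω, MeasurableSet E ∧ ENNReal.ofReal (1 - δ / 2) ≤ P E ∧ ∀ ω ∈ E,
      marginBound σ p
        ≤ feasibilityMargin k σ B R δ T p (fun n => x n ω) (fun n => y n ω) ∧
      ∀ n < T, ∀ (z : 𝒳) (θ : Θ),
        |f z - postMean (k θ) σ (fun i : Fin n => x i ω) (fun i => y i ω) z|
          ≤ betaSqrt k σ B R δ T n * postStd (k θ) σ (fun i : Fin n => x i ω) z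
            + √(lipVar σ n * resolution T)
            + lipMean σ (fun i : Fin n => y i ω) * resolution T := by
  have hσ0 : 0 < σ := by linarith
  have hδ2 : 0 < δ / 2 := by linarith
  have : CompactSpace 𝒳 := isCompact_iff_compactSpace.1 h𝒳
  have : CompactSpace Θ := isCompact_iff_compactSpace.1 hf.isCompact
  have hT2 : (2 : ℝ) ≤ T := by exact_mod_cast hT
  have hT0 : (0 : ℝ) < T := by linarith
  have hfB : ∀ θ, rkhsNorm (hk θ) f ≤ ENNReal.ofReal B := fun θ =>
    (le_iSup (fun θ => rkhsNorm (hk θ) f) θ).trans hf.norm_le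
  obtain ⟨θ₀, -⟩ := hf.mem_rkhs
  have hres : 0 < resolution T := by rw [resolution]; positivity
  obtain ⟨s, hscard, hs⟩ := exists_cover_card_eq hk_cont hres
  set N := coveringNumber k (resolution T) with hN
  have hN1 : (1 : ℝ) ≤ N := by
    obtain ⟨θ', hθ', -⟩ := hs θ₀
    exact_mod_cast hscard ▸ Finset.card_pos.2 ⟨θ', hθ'⟩
  have hkc : ∀ θ, Continuous fun q : 𝒳 × 𝒳 => k θ q.1 q.2 := fun θ =>
    hk_cont.comp (continuous_const.prodMk continuous_id)
  set L := Real.log (6 / δ) with hL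
  have hL0 : 0 ≤ L := Real.log_nonneg (by rw [le_div_iff₀ hδ₀]; linarith)
  have hlogN : 0 ≤ Real.log N := Real.log_nonneg hN1
  have hlog6 : Real.log (6 * N / δ) = L + Real.log N := by
    rw [hL, ← Real.log_mul (by positivity) (by positivity)]; congr 1; ring
  have hlog12 : Real.log (12 / δ) = L + Real.log 2 := by
    rw [hL, ← Real.log_mul (by positivity) (by positivity)]; congr 1; ring
  -- The gain $\log(3/2)\ge1/3$ comes from allotting $\delta/4$ to `bad₃`; it is spent in `hWle`,
  -- where $T=2$ is tight.
  have hlog4 : Real.log (4 / δ) ≤ L - 1 / 3 := by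
    have h1 : L = Real.log (4 / δ) + Real.log (3 / 2) := by
      rw [hL, ← Real.log_mul (by positivity) (by positivity)]; congr 1; ring
    have h2 := Real.one_sub_inv_le_log_of_pos (show (0 : ℝ) < 3 / 2 by norm_num)
    norm_num at h2
    linarith
  -- the three exceptional events
  set bad₁ : Θ → Set Ω := fun θ => {ω | ∃ n ≤ T, 6 * N / δ ≤
    Real.exp (fitQuad (k θ) σ (fun i : Fin n => x i ω) (fun i => ε i ω / R) / 2
      - infoGain (k θ) σ (fun i : Fin n => x i ω))} with hbad₁
  -- Prior variance $2T-1$ gives the coefficient $1-1/(2T)$, which exceeds the factor $1-1/T$ of the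
  -- crude bound.
  set bad₂ : Set Ω := {ω | ∃ n ≤ T, 12 / δ ≤ Real.exp ((2 * T - 1) / (1 + (2 * T - 1)) / 2
    * ∑ i ∈ Finset.range n, (ε i ω / R) ^ 2 - n * (Real.log (1 + (2 * T - 1)) / 2))} with hbad₂
  -- A moderate variance keeps the cost at $\log 2$ per round, as the margin requires. The shares
  -- $\delta/6+\delta/12+\delta/4$ add up to $\delta/2$.
  set bad₃ : Set Ω := {ω | ∃ n ≤ T, 4 / δ ≤ Real.exp (3 / (1 + 3) / 2
    * ∑ i ∈ Finset.range n, (ε i ω / R) ^ 2 - n * (Real.log (1 + 3) / 2))} with hbad₃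
  set bad : Set Ω := ((⋃ θ ∈ s, bad₁ θ) ∪ bad₂) ∪ bad₃ with hbad
  have hPbad : P bad ≤ ENNReal.ofReal (δ / 2) := by
    have h1 : P (⋃ θ ∈ s, bad₁ θ) ≤ ENNReal.ofReal (δ / 6) := by
      refine (measure_biUnion_finset_le s _).trans ?_
      refine (Finset.sum_le_sum fun θ _ => measure_exists_le_exp_fitQuad (hk θ) (hkc θ) hσ0 hR hx
        hε hsub (show 0 < 6 * N / δ by positivity)).trans (le_of_eq ?_)
      rw [Finset.sum_const, hscard, nsmul_eq_mul, ← ENNReal.ofReal_natCast,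
        ← ENNReal.ofReal_mul (by positivity)]
      congr 1
      field_simp
    have h2 : P bad₂ ≤ ENNReal.ofReal (δ / 12) := by
      have := measure_exists_le_exp_sum_sq hR hε hsub (show (0 : ℝ) ≤ 2 * T - 1 by linarith)
        (show 0 < 12 / δ by positivity)
      rwa [inv_div] at this
    have h3 : P bad₃ ≤ ENNReal.ofReal (δ / 4) := by
      have := measure_exists_le_exp_sum_sq hR hε hsub (show (0 : ℝ) ≤ 3 by norm_num)
        (show 0 < 4 / δ by positivity)
      rwa [inv_div] at this
    calc P bad ≤ P (⋃ θ ∈ s, bad₁ θ) + P bad₂ + P bad₃ :=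
          (measure_union_le _ _).trans (by gcongr; exact measure_union_le _ _)
      _ ≤ ENNReal.ofReal (δ / 6) + ENNReal.ofReal (δ / 12) + ENNReal.ofReal (δ / 4) := by gcongr
      _ = ENNReal.ofReal (δ / 2) := by
          rw [← ENNReal.ofReal_add (by positivity) (by positivity),
            ← ENNReal.ofReal_add (by positivity) (by positivity)]
          congr 1; ring
  -- A measurable hull of `bad` has the same probability, so measurability of `bad` itself is not
  -- needed.
  refine ⟨marginBound_pos hσ, (toMeasurable P bad)ᶜ, (measurableSet_toMeasurable P bad).compl,
    ?_, fun ω hω => ?_⟩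
  · rw [prob_compl_eq_one_sub (measurableSet_toMeasurable P bad), measure_toMeasurable,
      ENNReal.ofReal_sub _ hδ2.le, ENNReal.ofReal_one]
    gcongr
  have hωbad : ω ∉ bad := fun h => hω (subset_toMeasurable P bad h)
  simp only [hbad, Set.mem_union, Set.mem_iUnion, not_or, not_exists] at hωbad
  obtain ⟨⟨hω₁, hω₂⟩, hω₃⟩ := hωbad
  have hgood₁ : ∀ θ ∈ s, ∀ n ≤ T,
      fitQuad (k θ) σ (fun i : Fin n => x i ω) (fun i => ε i ω / R) / 2
        - infoGain (k θ) σ (fun i : Fin n => x i ω) < L + Real.log N := fun θ hθ n hn => by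
    rw [← hlog6, Real.lt_log_iff_exp_lt (by positivity)]
    exact not_le.1 fun h => hω₁ θ hθ ⟨n, hn, h⟩
  have hgood₂ : ∀ n ≤ T, (2 * T - 1) / (2 * (T : ℝ)) / 2
      * ∑ i ∈ Finset.range n, (ε i ω / R) ^ 2 - n * (Real.log (2 * T) / 2)
        < L + Real.log 2 := fun n hn => by
    rw [← hlog12, Real.lt_log_iff_exp_lt (by positivity)]
    refine not_le.1 fun h => hω₂ ⟨n, hn, ?_⟩
    rwa [show (1 : ℝ) + (2 * T - 1) = 2 * T by ring]
  have hgood₃ : 3 / 8 * ∑ i ∈ Finset.range T, (ε i ω / R) ^ 2 - T * Real.log 2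
      < L - 1 / 3 := by
    refine lt_of_lt_of_le ?_ hlog4
    rw [Real.lt_log_iff_exp_lt (by positivity)]
    refine not_le.1 fun h => hω₃ ⟨T, le_rfl, ?_⟩
    rwa [show (1 : ℝ) + 3 = 2 ^ 2 by norm_num, Real.log_pow,
      show (3 : ℝ) / 2 ^ 2 / 2 = 3 / 8 by norm_num,
      show ((2 : ℕ) : ℝ) * Real.log 2 / 2 = Real.log 2 by push_cast; ring]
  have hΓ : ∀ n, 0 ≤ familyInfoGain k σ n :=
    familyInfoGain_nonneg hk hk_le hσ θ₀ (x 0 ω)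
  have hnormsq : ∀ n : ℕ, (fun i : Fin n => ε i ω / R) ⬝ᵥ (fun i : Fin n => ε i ω / R)
      = ∑ i ∈ Finset.range n, (ε i ω / R) ^ 2 := fun n => by
    rw [← Fin.sum_univ_eq_sum_range (fun i => (ε i ω / R) ^ 2)]
    simp [dotProduct, sq]
  have hscale : ∀ n : ℕ, (fun i : Fin n => ε i ω) = fun i : Fin n => R * (ε i ω / R) := fun n => by
    funext i; field_simp
  have hyn : ∀ n ≤ T, (fun i : Fin n => y i ω) = fun i : Fin n => f (x i ω) + ε i ω :=
    fun n hn => by funext i; exact hy i (by omega) ω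
  refine ⟨?_, fun n hn z θ => ?_⟩
  · set W := ∑ i ∈ Finset.range T, (ε i ω / R) ^ 2 with hW
    have hW0 : 0 ≤ W := Finset.sum_nonneg fun _ _ => sq_nonneg _
    have hWle : W ≤ 3 / 4 * T * (2 * (1 + L)) := by
      have := Real.log_two_lt_d9
      have h1 : T * Real.log 2 ≤ T * (7 / 10) := by gcongr; linarith
      have h2 : 5 / 6 ≤ L := by
        have h3 := Real.one_sub_inv_le_log_of_pos (show 0 < 6 / δ by positivity)
        rw [inv_div] at h3
        linarith
      nlinarith [mul_nonneg (sub_nonneg.2 hT2) (sub_nonneg.2 h2)]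
    set b₀ := √(2 * (1 + L)) with hb₀
    have hb₀0 : 0 ≤ b₀ := Real.sqrt_nonneg _
    refine marginBound_le_feasibilityMargin hσ (by omega) hp hk _ _ θ₀
      (b := B + R * b₀) (by positivity) (fun n => ?_) ?_
    · rw [betaSqrt, ← hN, hlog6, hb₀]
      have h : 2 * (1 + L) ≤ 2 * (familyInfoGain k σ n + 1 + (L + Real.log N)) := by
        linarith [hΓ n]
      linarith [mul_le_mul_of_nonneg_left (Real.sqrt_le_sqrt h) hR.le]
    · have h1 : invQuad (k θ₀) σ (fun i : Fin T => x i ω) (fun i => ε i ω) ≤ (R * √W) ^ 2 := by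
        refine ((hk θ₀).invQuad_le hσ0 _ _).trans ?_
        have : (fun i : Fin T => ε i ω) ⬝ᵥ (fun i : Fin T => ε i ω) = (R * √W) ^ 2 := by
          rw [mul_pow, Real.sq_sqrt hW0, hW, ← hnormsq, hscale]
          change (R • fun i : Fin T => ε i ω / R) ⬝ᵥ (R • fun i : Fin T => ε i ω / R) = _
          rw [smul_dotProduct, dotProduct_smul, smul_eq_mul, smul_eq_mul]
          ring
        rw [this]
        exact div_le_self (sq_nonneg _) (by nlinarith)
      have h2 := (hk θ₀).invQuad_add_le hσ0 (fun i : Fin T => x i ω) hB.le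
        (by positivity : 0 ≤ R * √W)
        ((hk θ₀).invQuad_rkhs_le hσ0 hB.le (hfB θ₀) (fun i : Fin T => x i ω)) h1
      rw [hyn T le_rfl]
      refine le_trans h2 ?_
      -- Since $T\ge2$, `c` is at least $1$, so the bias `B`, which does not grow with $T$, is
      -- absorbed into `c * B`.
      set c := √(3 / 4 * T) with hc
      have hc2 : c ^ 2 = 3 / 4 * T := Real.sq_sqrt (by positivity)
      have hc1 : 1 ≤ c := Real.one_le_sqrt.2 (by linarith)
      have h3 : √W ≤ c * b₀ := by
        rw [hc, hb₀, ← Real.sqrt_mul (by positivity)]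
        exact Real.sqrt_le_sqrt hWle
      rw [← hc2, ← mul_pow]
      have h4 : R * √W ≤ R * (c * b₀) := by gcongr
      have h5 : B ≤ c * B := le_mul_of_one_le_left hB.le hc1
      refine pow_le_pow_left₀ (by positivity) ?_ 2
      linarith
  · obtain ⟨θ', hθ's, hθ'⟩ := hs θ
    -- The net is needed only for this scalar, so the posterior mean and variance stay at `θ`
    -- itself.
    have hfit : fitQuad (k θ) σ (fun i : Fin n => x i ω) (fun i => ε i ω / R)
        ≤ 2 * (familyInfoGain k σ n + (L + Real.log N) + 1) := by
      have hq' := hgood₁ θ' hθ's n hn.le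
      have hig := infoGain_le_familyInfoGain hk hk_le hσ θ' (fun i : Fin n => x i ω)
      have hcrude := (hk θ).fitQuad_le (hk_le θ) hσ0 (fun i : Fin n => x i ω)
        (fun i => ε i ω / R)
      have hnear := (hk θ).fitQuad_le_add (hk θ') hσ0 hres.le
        (fun u u' => (abs_sub_le_kernelDist (hk θ) (hk θ') (hk_le θ) (hk_le θ') u u').trans hθ')
        (fun i : Fin n => x i ω) (fun i => ε i ω / R)
      rw [hnormsq] at hcrude hnear
      have hnT : (n : ℝ) ≤ T - 1 := by
        have : n + 1 ≤ T := hn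
        have : ((n + 1 : ℕ) : ℝ) ≤ T := by exact_mod_cast this
        push_cast at this
        linarith
      exact noise_le_of_norm_le hT2 (Nat.cast_nonneg n) hnT
        (Finset.sum_nonneg fun _ _ => sq_nonneg _) hL0 (by nlinarith : 1 ≤ σ ^ 2)
        (by linarith [hΓ n]) (hgood₂ n hn.le) hcrude hnear (by linarith)
    have hbound := (hk θ).abs_sub_postMean_le hσ0 hB.le (hfB θ) (fun i : Fin n => x i ω)
      (fun i => ε i ω) z
    have hnoise : √(fitQuad (k θ) σ (fun i : Fin n => x i ω) (fun i => ε i ω) / σ ^ 2)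
        ≤ R * √(2 * (familyInfoGain k σ n + 1 + (L + Real.log N))) := by
      have h0 := (hk θ).fitQuad_nonneg hσ0 (fun i : Fin n => x i ω) (fun i => ε i ω / R)
      have h1 : R = √(R ^ 2) := (Real.sqrt_sq hR.le).symm
      rw [hscale, fitQuad_smul]
      conv_rhs => rw [h1, ← Real.sqrt_mul (sq_nonneg R)]
      refine Real.sqrt_le_sqrt ((div_le_self (by positivity) (by nlinarith)).trans ?_)
      gcongr
      linarith
    rw [hyn n hn.le, betaSqrt, ← hN, hlog6]
    have hstd : 0 ≤ postStd (k θ) σ (fun i : Fin n => x i ω) z := Real.sqrt_nonneg _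
    have hmain : |f z - postMean (k θ) σ (fun i : Fin n => x i ω)
        (fun i => f (x i ω) + ε i ω) z|
        ≤ (B + R * √(2 * (familyInfoGain k σ n + 1 + (L + Real.log N))))
          * postStd (k θ) σ (fun i : Fin n => x i ω) z := hbound.trans (by gcongr)
    -- `hmain` is already the bound without slack; both Lipschitz terms enter only through being
    -- nonnegative.
    have hlip : 0 ≤ lipMean σ (fun i : Fin n => f (x i ω) + ε i ω) * resolution T := by
      rw [lipMean]; positivity
    have := Real.sqrt_nonneg (lipVar σ n * resolution T)
    linarith
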